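/- Write $\mathbb R^+=(0,\infty)$, let $\lambda$ be Lebesgue measure on $\mathbb R^+$, and let the scalar field of all function spaces be $\mathbb R$ or $\mathbb C$ (the result holds for each). **Setting.** Let $T:\mathbb R^+\to\mathbb R^+$, and let $a_1>a_2>\dots\ge 0$ be a sequence which is either finite, with last element $a_N=0$ ($N\ge 1$), or infinite ($N=\infty$), with $\lim_n a_n=0$. Put $I_0=(a_1,\infty)$ and $I_j=(a_{j+1},a_j)$ for $1\le j<N$. Assume: - (B1) For each $0\le j<N$, $T|_{I_j}$ is a bijection onto $\mathbb R^+$ and has an extension $\tau_j$, which is $C^2$ up to the boundary, defined on $[a_1,\infty)$ if $j=0$ and on $[a_{j+1},a_j)$ or $(a_{j+1},a_j]$ if $j\ge 1$. - (B2) There is $\Lambda>1$ with $|\tau_j'|\ge\Lambda$ for all $j\ge 1$. - (B3) There is $K>0$ with $|\tau_j''|/|\tau_j'|^2\le K$ for all $j\ge 0$. - (B4) $u(x)=x-\tau_0(x)$ is positive and convex on $(a_1,\infty)$, $u(x)\to 0$ as $x\to+\infty$, and $u''$ is decreasing (not necessarily strictly). - (B5) $T$ preserves $\lambda$: $\lambda(T^{-1}A)=\lambda(A)$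 for every measurable $A\subseteq\mathbb R^+$. **Observables.** For $F\in L^\infty(\mathbb R^+,\lambda)$ and $a>0$ let $\lambda_{(0,a]}(F)=\frac1a\int_0^a F\,d\lambda$, and let $\overline\lambda(F)=\lim_{a\to+\infty}\lambda_{(0,a]}(F)$ if this limit exists. Let $\mathcal G$ be the set of $F\in L^\infty(\mathbb R^+,\lambda)$ for which $\overline\lambda(F)$ exists, let $\mathcal L=L^1(\mathbb R^+,\lambda)$, and write $\lambda(g)=\int_0^\infty g\,d\lambda$. **Mixing properties.** - (GLM1) For all $F\in\mathcal G$ and all $g\in\mathcal L$ with $\lambda(g)=0$, $\lim_{n\to\infty}\lambda((F\circ T^n)g)=0$. - (GLM3) For all $F\in\mathcal G$, $\displaystyle\lim_{n\to\infty}\sup_{g\in\mathcal L\setminus\{0\}}\frac{|\lambda((F\circ T^n)g)-\overline\lambda(F)\lambda(g)|}{\lambda(|g|)}=0$. - (LLM) For all $f\in\mathcal L\cap\mathcal G$ and $g\in\mathcal L$, $\lim_{n\to\infty}\lambda((f\circ T^n)g)=0$. - (GGM1) For all $F,G\in\mathcal G$, $\overline\lambda((F\circ T^n)G)$ exists for all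 large $n$ and $\lim_{n\to\infty}\overline\lambda((F\circ T^n)G)=\overline\lambda(F)\,\overline\lambda(G)$. - (GGM2) For all $F,G\in\mathcal G$ and $\varepsilon>0$ there is $M>0$ such that $|\lambda_{(0,a]}((F\circ T^n)G)-\overline\lambda(F)\,\overline\lambda(G)|<\varepsilon$ for all real $a\ge M$ and all integers $n\ge M$. **Proposition.** If $T$ satisfies (B1)–(B5), then $T$ has properties (GLM1) and (LLM), but has none of the properties (GLM3), (GGM1), (GGM2). Property (GGM1) fails even if it is required only of those pairs $F,G\in\mathcal G$ for which $\overline\lambda((F\circ T^n)G)$ exists for every $n\ge 0$. -/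

import Mathlib

open MeasureTheory Set Filter Topology

namespace HalfLine

/-- Lebesgue measure on the open half-line `ℝ⁺ = (0, ∞)`, as a measure on `ℝ`. -/
noncomputable abbrev leb : Measure ℝ := volume.restrict (Ioi 0)

/-- The open intervals of the partition: `I₀ = (a₁, ∞)` and `I_j = (a_{j+1}, a_j)` for `j ≥ 1`.
The value `a 0` is not used. -/
def interval (a : ℕ → ℝ) : ℕ → Set ℝ
  | 0 => Ioi (a 1)
  | j + 1 => Ioo (a (j + 2)) (a (j + 1))

/-- `a₁ > a₂ > ⋯ ≥ 0` is a sequence of `N ∈ {1, 2, …, ∞}` numbers, with last element `a_N = 0` if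
`N` is finite, and with limit `0` if `N = ∞`. The partition has the intervals `I_j`, `j < N`. -/
structure IsPartition (N : ℕ∞) (a : ℕ → ℝ) : Prop where
  one_le : 1 ≤ N
  strictAnti : ∀ j : ℕ, 1 ≤ j → ((j + 1 : ℕ) : ℕ∞) ≤ N → a (j + 1) < a j
  nonneg : ∀ j : ℕ, 1 ≤ j → (j : ℕ∞) ≤ N → 0 ≤ a j
  last : ∀ n : ℕ, N = (n : ℕ∞) → a n = 0
  lim : N = ⊤ → Tendsto a atTop (𝓝 0)

/-- Conditions (B1)-(B5) on a map `T : ℝ⁺ → ℝ⁺` (the values of `T` outside `ℝ⁺` are irrelevant),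
with respect to the partition given by `N` and `a`. For `j < N` the function `τ j` is the extension
of the branch `T|_{I_j}` to the (half-)closed interval; its values elsewhere are irrelevant.
The bounds on derivatives are written on the open intervals `I_j`, which is the same as on the
domains of the extensions because these are `C²` up to the boundary. -/
structure IsIntermittent (T : ℝ → ℝ) (N : ℕ∞) (a : ℕ → ℝ) (τ : ℕ → ℝ → ℝ) : Prop where
  mapsTo : MapsTo T (Ioi 0) (Ioi 0)
  partition : IsPartition N a
  /-- (B1): full branches. -/
  bijOn : ∀ j : ℕ, (j : ℕ∞) < N → BijOn T (interval a j) (Ioi 0)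
  /-- (B1): `τ j` extends the branch. -/
  eqOn : ∀ j : ℕ, (j : ℕ∞) < N → EqOn (τ j) T (interval a j)
  /-- (B1): `τ 0` is `C²` on `[a₁, ∞)`. -/
  contDiffOn_zero : ContDiffOn ℝ 2 (τ 0) (Ici (a 1))
  /-- (B1): for `j ≥ 1`, `τ j` is `C²` on `[a_{j+1}, a_j)` or on `(a_{j+1}, a_j]`. -/
  contDiffOn : ∀ j : ℕ, 1 ≤ j → (j : ℕ∞) < N →
    ContDiffOn ℝ 2 (τ j) (Ico (a (j + 1)) (a j)) ∨ ContDiffOn ℝ 2 (τ j) (Ioc (a (j + 1)) (a j))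
  /-- (B2): uniform expansion away from infinity. -/
  expanding : ∃ Λ : ℝ, 1 < Λ ∧ ∀ j : ℕ, 1 ≤ j → (j : ℕ∞) < N →
    ∀ x ∈ interval a j, Λ ≤ |deriv (τ j) x|
  /-- (B3): bounded second derivative relative to the square of the first. -/
  distortion : ∃ K : ℝ, 0 < K ∧ ∀ j : ℕ, (j : ℕ∞) < N →
    ∀ x ∈ interval a j, |deriv (deriv (τ j)) x| / |deriv (τ j) x| ^ 2 ≤ K
  /-- (B4): `u(x) = x - τ₀(x)` is positive. -/
  u_pos : ∀ x ∈ Ioi (a 1), 0 < x - τ 0 x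
  /-- (B4): `u` is convex. -/
  u_convex : ConvexOn ℝ (Ici (a 1)) (fun x => x - τ 0 x)
  /-- (B4): `u` vanishes at infinity. -/
  u_tendsto : Tendsto (fun x => x - τ 0 x) atTop (𝓝 0)
  /-- (B4): `u''` is decreasing. -/
  u_deriv2 : AntitoneOn (deriv (deriv (fun x => x - τ 0 x))) (Ioi (a 1))
  /-- (B5): `T` preserves Lebesgue measure on `ℝ⁺`. -/
  preserves : ∀ A ⊆ Ioi (0 : ℝ), MeasurableSet A → volume (Ioi 0 ∩ T ⁻¹' A) = volume A

section Observables

variable {𝕜 : Type*} [RCLike 𝕜]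

/-- The average of `F` over the box `(0, a]`. -/
noncomputable def boxAvg (F : ℝ → 𝕜) (a : ℝ) : 𝕜 :=
  a⁻¹ • ∫ x in Ioc 0 a, F x

/-- The infinite-volume average of `F` exists and equals `ℓ`. -/
def HasAvg (F : ℝ → 𝕜) (ℓ : 𝕜) : Prop :=
  Tendsto (boxAvg F) atTop (𝓝 ℓ)

/-- Global observables: `F ∈ L^∞(ℝ⁺)` whose infinite-volume average exists. -/
def IsGlobal (F : ℝ → 𝕜) : Prop :=
  MemLp F ⊤ leb ∧ ∃ ℓ : 𝕜, HasAvg F ℓ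

/-- Local observables: `g ∈ L¹(ℝ⁺)`. -/
def IsLocal (g : ℝ → 𝕜) : Prop :=
  Integrable g leb

end Observables

section Mixing

variable (𝕜 : Type*) [RCLike 𝕜] (T : ℝ → ℝ)

/-- Global-local mixing of type (GLM1). -/
def GLM1 : Prop :=
  ∀ F g : ℝ → 𝕜, IsGlobal F → IsLocal g → ∫ x, g x ∂leb = 0 →
    Tendsto (fun n : ℕ => ∫ x, F (T^[n] x) * g x ∂leb) atTop (𝓝 0)

/-- Global-local mixing of type (GLM3); the supremum over `g ∈ L¹ ∖ {0}` is taken in `[0, ∞]`. -/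
def GLM3 : Prop :=
  ∀ (F : ℝ → 𝕜) (ℓ : 𝕜), IsGlobal F → HasAvg F ℓ →
    Tendsto (fun n : ℕ => ⨆ (g : ℝ → 𝕜) (_ : IsLocal g) (_ : ∫ x, ‖g x‖ ∂leb ≠ 0),
      ENNReal.ofReal (‖(∫ x, F (T^[n] x) * g x ∂leb) - ℓ * ∫ x, g x ∂leb‖ / ∫ x, ‖g x‖ ∂leb))
      atTop (𝓝 0)

/-- Local-local mixing (LLM). -/
def LLM : Prop :=
  ∀ f g : ℝ → 𝕜, IsLocal f → IsGlobal f → IsLocal g →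
    Tendsto (fun n : ℕ => ∫ x, f (T^[n] x) * g x ∂leb) atTop (𝓝 0)

/-- Global-global mixing of type (GGM1): for all global `F`, `G` the infinite-volume average of
`(F ∘ Tⁿ) G` exists for all large `n` and converges to the product of the averages. -/
def GGM1 : Prop :=
  ∀ (F G : ℝ → 𝕜) (ℓF ℓG : 𝕜), IsGlobal F → IsGlobal G → HasAvg F ℓF → HasAvg G ℓG →
    ∃ A : ℕ → 𝕜, (∀ᶠ n in atTop, HasAvg (fun x => F (T^[n] x) * G x) (A n)) ∧
      Tendsto A atTop (𝓝 (ℓF * ℓG))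

/-- The least demanding reading of (GGM1): the limit relation is required only for those global
`F`, `G` for which the infinite-volume average of `(F ∘ Tⁿ) G` exists for every `n`. -/
def WeakGGM1 : Prop :=
  ∀ (F G : ℝ → 𝕜) (ℓF ℓG : 𝕜), IsGlobal F → IsGlobal G → HasAvg F ℓF → HasAvg G ℓG →
    ∀ A : ℕ → 𝕜, (∀ n, HasAvg (fun x => F (T^[n] x) * G x) (A n)) →
      Tendsto A atTop (𝓝 (ℓF * ℓG))

/-- Global-global mixing of type (GGM2): joint infinite-volume and time limit. -/
def GGM2 : Prop :=
  ∀ (F G : ℝ → 𝕜) (ℓF ℓG : 𝕜), IsGlobal F → IsGlobal G → HasAvg F ℓF → HasAvg G ℓG →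
    ∀ ε : ℝ, 0 < ε → ∃ M : ℝ, 0 < M ∧ ∀ a : ℝ, M ≤ a → ∀ n : ℕ, M ≤ n →
      ‖boxAvg (fun x => F (T^[n] x) * G x) a - ℓF * ℓG‖ < ε

end Mixing

end HalfLine

open scoped ComplexConjugate

namespace HalfLine


section Abstract

variable {α : Type*} [m0 : MeasurableSpace α] {𝕜 : Type*} [RCLike 𝕜]

/-- A sequence of measurable sets with `C n = T⁻¹ (C (n + 1))` almost everywhere; `C 0` is then a
set of the tail σ-algebra of `T`. -/
def IsTailSeq (ν : Measure α) (T : α → α) (C : ℕ → Set α) : Prop :=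
  ∀ n, MeasurableSet (C n) ∧ C n =ᵐ[ν] T ⁻¹' C (n + 1)

/-- Every set of the tail σ-algebra of `T` is null or conull. -/
def TailTrivial (ν : Measure α) (T : α → α) : Prop :=
  ∀ C : ℕ → Set α, IsTailSeq ν T C → (∀ᵐ x ∂ν, x ∈ C 0) ∨ ∀ᵐ x ∂ν, x ∉ C 0

lemma ae_of_ae_comp {ν : Measure α} {T : α → α} (hT : MeasurePreserving T ν ν) {p : α → Prop}
    (hp : MeasurableSet {x | p x}) (h : ∀ᵐ x ∂ν, p (T x)) : ∀ᵐ x ∂ν, p x := by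
  rw [← hT.map_eq]
  exact (ae_map_iff hT.measurable.aemeasurable hp).2 h

lemma eventuallyEq_set_of_preimage {ν : Measure α} {T : α → α} (hT : MeasurePreserving T ν ν)
    {A B : Set α} (hA : MeasurableSet A) (hB : MeasurableSet B) (h : T ⁻¹' A =ᵐ[ν] T ⁻¹' B) :
    A =ᵐ[ν] B := by
  have : ∀ᵐ x ∂ν, (x ∈ A ↔ x ∈ B) := by
    refine ae_of_ae_comp hT (p := fun x => x ∈ A ↔ x ∈ B) ?_ ?_
    · have : {x | x ∈ A ↔ x ∈ B} = (A ∩ B) ∪ (Aᶜ ∩ Bᶜ) := by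
        ext x; simp only [mem_ofPred_eq, mem_union, mem_inter_iff, mem_compl_iff]; tauto
      rw [this]
      exact (hA.inter hB).union (hA.compl.inter hB.compl)
    · exact eventuallyEq_set.1 h
  exact eventuallyEq_set.2 this

/-- A function that is measurable with respect to `T⁻ⁿ 𝓑` for every `n` is constant. -/
lemma ae_const_of_forall_comap {ν μ : Measure α} (hμν : μ ≪ ν) (hνμ : ν ≪ μ) {T : α → α}
    (hT : MeasurePreserving T ν ν) (htriv : TailTrivial ν T) {v : α → 𝕜}
    (hv : ∀ n : ℕ, AEStronglyMeasurable[m0.comap (T^[n])] v μ) : ∃ c : 𝕜, ∀ᵐ x ∂μ, v x = c := by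
  have key : ∀ n : ℕ, ∃ f : α → 𝕜, StronglyMeasurable f ∧ v =ᵐ[ν] f ∘ T^[n] := by
    intro n
    obtain ⟨w, hw, hvw⟩ := hv n
    obtain ⟨f, hf, rfl⟩ := hw.exists_eq_measurable_comp
    exact ⟨f, hf, hνμ.ae_eq hvw⟩
  choose f hf hvf using key
  refine exists_eventuallyEq_const_of_forall_separating (β := 𝕜) (l := ae μ) (f := v)
    MeasurableSet fun U hU => ?_
  have hC : IsTailSeq ν T fun n => f n ⁻¹' U := by
    intro n
    refine ⟨(hf n).measurable hU, ?_⟩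
    refine eventuallyEq_set_of_preimage (hT.iterate n) ((hf n).measurable hU)
      (hT.measurable ((hf _).measurable hU)) ?_
    refine eventuallyEq_set.2 ?_
    filter_upwards [hvf n, hvf (n + 1)] with x h1 h2
    simp only [mem_preimage]
    rw [Function.comp_apply] at h1 h2
    rw [← h1, ← Function.iterate_succ_apply' T n x, ← h2]
  have h0 := hvf 0
  rcases htriv _ hC with h | h
  · left
    filter_upwards [hμν.ae_le h, hμν.ae_le h0] with x h1 h2
    rw [h2]; exact h1
  · right
    filter_upwards [hμν.ae_le h, hμν.ae_le h0] with x h1 h2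
    rw [h2]; exact h1

lemma comap_iterate_antitone {T : α → α} (hT : Measurable T) :
    Antitone fun n : ℕ => m0.comap (T^[n]) := by
  refine antitone_nat_of_succ_le fun n => ?_
  rw [Function.iterate_succ', ← MeasurableSpace.comap_comp]
  exact MeasurableSpace.comap_mono hT.comap_le

lemma tendsto_integral_mul_of_tailTrivial {ν μ : Measure α} [IsFiniteMeasure μ]
    (hμν : μ ≪ ν) (hνμ : ν ≪ μ) {T : α → α} (hT : MeasurePreserving T ν ν)
    (htriv : TailTrivial ν T) {h : α → 𝕜} (hh : MemLp h 2 μ) (h0 : ∫ x, h x ∂μ = 0)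
    {G : ℕ → α → 𝕜} {R : ℝ} (hG : ∀ n, AEStronglyMeasurable[m0.comap (T^[n])] (G n) μ)
    (hR : ∀ n, ∀ᵐ x ∂μ, ‖G n x‖ ≤ R) :
    Tendsto (fun n => ∫ x, G n x * h x ∂μ) atTop (𝓝 0) := by
  have hle : ∀ n : ℕ, m0.comap (T^[n]) ≤ m0 := fun n => (hT.measurable.iterate n).comap_le
  have : ∀ n : ℕ, Fact (m0.comap (T^[n]) ≤ m0) := fun n => ⟨hle n⟩
  set V : ℕ → Submodule 𝕜 (Lp 𝕜 2 μ) := fun n => lpMeas 𝕜 𝕜 (m0.comap (T^[n])) 2 μ with hV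
  have hVanti : Antitone V := by
    intro i j hij f hf
    exact AEStronglyMeasurable.mono (comap_iterate_antitone hT.measurable hij) hf
  have hmem : hh.toLp h ∈ (⨆ n, (V n)ᗮ).topologicalClosure := by
    rw [← Submodule.orthogonal_orthogonal_eq_closure, ← Submodule.iInf_orthogonal]
    have : ∀ n, (V n)ᗮᗮ = V n := fun n => by
      have : CompleteSpace (V n) := by rw [hV]; infer_instance
      exact Submodule.orthogonal_orthogonal _
    simp only [this]
    intro v hv
    obtain ⟨c, hc⟩ := ae_const_of_forall_comap (v := v) hμν hνμ hT htriv
      (fun n => (Submodule.mem_iInf _).1 hv n)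
    rw [L2.inner_def]
    have : ∀ᵐ x ∂μ, inner 𝕜 (v x) (hh.toLp h x) = conj c * h x := by
      filter_upwards [hc, hh.coeFn_toLp] with x h1 h2
      rw [h1, h2, RCLike.inner_apply, mul_comm]
    rw [integral_congr_ae this, integral_const_mul, h0, mul_zero]
  have hR0 : 0 ≤ R ∨ μ = 0 := by
    by_contra! hcon
    have : NeZero μ := ⟨hcon.2⟩
    obtain ⟨x, hx⟩ := (hR 0).exists
    linarith [norm_nonneg (G 0 x)]
  rcases hR0 with hR0 | rfl
  swap
  · simp
  have hGL : ∀ n, MemLp (fun x => conj (G n x)) 2 μ := fun n =>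
    MemLp.of_bound (RCLike.continuous_conj.comp_aestronglyMeasurable ((hG n).mono (hle n))) R
      (by simpa using hR n)
  have hnorm : ∀ n, ‖(hGL n).toLp‖ ≤ (μ.real univ) ^ ((2 : ENNReal).toReal⁻¹) * R := fun n =>
    Lp.norm_le_of_ae_bound hR0 (by
      filter_upwards [hR n, (hGL n).coeFn_toLp] with x h1 h2
      rw [h2]; simpa using h1)
  have hGV : ∀ n, (hGL n).toLp ∈ V n := fun n => by
    refine AEStronglyMeasurable.congr ?_ (hGL n).coeFn_toLp.symm
    exact RCLike.continuous_conj.comp_aestronglyMeasurable (hG n)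
  have hint : ∀ n, ∫ x, G n x * h x ∂μ = inner 𝕜 (hGL n).toLp (hh.toLp h) := fun n => by
    rw [L2.inner_def]
    refine integral_congr_ae ?_
    filter_upwards [hh.coeFn_toLp, (hGL n).coeFn_toLp] with x h1 h2
    rw [h1, h2, RCLike.inner_apply, RCLike.conj_conj, mul_comm]
  set B := (μ.real univ) ^ ((2 : ENNReal).toReal⁻¹) * R
  have hB : 0 ≤ B := (norm_nonneg _).trans (hnorm 0)
  rw [Metric.tendsto_atTop]
  intro ε hε
  obtain ⟨k, hk, hkd⟩ := Metric.mem_closure_iff.1 hmem (ε / (B + 1)) (by positivity)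
  have hdir : Directed (· ≤ ·) fun n => (V n)ᗮ :=
    Monotone.directed_le fun i j hij => Submodule.orthogonal_le (hVanti hij)
  obtain ⟨m, hm⟩ := (Submodule.mem_iSup_of_directed _ hdir).1 hk
  refine ⟨m, fun n hn => ?_⟩
  have hz : inner 𝕜 (hGL n).toLp k = (0 : 𝕜) := hm _ (hVanti hn (hGV n))
  have : inner 𝕜 (hGL n).toLp (hh.toLp h) = inner 𝕜 (hGL n).toLp (hh.toLp h - k) := by
    rw [inner_sub_right, hz, sub_zero]
  rw [dist_zero_right, hint, this]
  calc _ ≤ ‖(hGL n).toLp‖ * ‖hh.toLp h - k‖ := norm_inner_le_norm _ _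
    _ ≤ B * (ε / (B + 1)) := by
        rw [← dist_eq_norm]
        gcongr
        exact hnorm n
    _ < (B + 1) * (ε / (B + 1)) := by gcongr; linarith
    _ = ε := by field_simp

/-- If the tail σ-algebra is trivial, then bounded functions mix with mean zero functions. -/
theorem TailTrivial.tendsto_integral_comp_iterate_mul {ν : Measure α} [SigmaFinite ν] {T : α → α}
    (hT : MeasurePreserving T ν ν) (htriv : TailTrivial ν T) {F g : α → 𝕜} (hF : MemLp F ⊤ ν)
    (hg : Integrable g ν) (h0 : ∫ x, g x ∂ν = 0) :
    Tendsto (fun n : ℕ => ∫ x, F (T^[n] x) * g x ∂ν) atTop (𝓝 0) := by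
  obtain ⟨g', hg'm, hgg'⟩ := hg.1
  obtain ⟨w₀, hw₀, hw₀m, hw₀i⟩ := exists_pos_lintegral_lt_of_sigmaFinite ν one_ne_zero
  set w : α → NNReal := fun x => ‖g' x‖₊ + w₀ x with hw
  have hwm : Measurable w := hg'm.measurable.nnnorm.add hw₀m
  have hwpos : ∀ x, 0 < w x := fun x => add_pos_of_nonneg_of_pos zero_le (hw₀ x)
  set μ := ν.withDensity fun x => (w x : ENNReal) with hμ
  have hμν : μ ≪ ν := withDensity_absolutelyContinuous _ _
  have hνμ : ν ≪ μ := withDensity_absolutelyContinuous' hwm.coe_nnreal_ennreal.aemeasurable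
    (ae_of_all _ fun x => by simpa using (hwpos x).ne')
  have : IsFiniteMeasure μ := by
    refine isFiniteMeasure_withDensity ?_
    have h1 : ∫⁻ x, (w x : ENNReal) ∂ν = ∫⁻ x, ‖g' x‖ₑ ∂ν + ∫⁻ x, (w₀ x : ENNReal) ∂ν := by
      rw [← lintegral_add_left hg'm.measurable.enorm]
      simp [hw, enorm_eq_nnnorm]
    rw [h1]
    exact ENNReal.add_ne_top.2 ⟨((hg.congr hgg').2).ne, (hw₀i.trans ENNReal.one_lt_top).ne⟩
  set h : α → 𝕜 := fun x => ((w x : ℝ)⁻¹ : ℝ) • g' x with hh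
  have hhm : AEStronglyMeasurable h μ :=
    (hwm.coe_nnreal_real.inv.stronglyMeasurable.smul hg'm).aestronglyMeasurable
  have hwh : ∀ x, w x • h x = g' x := fun x => by
    have : (w x : ℝ) ≠ 0 := by exact_mod_cast (hwpos x).ne'
    simp only [hh, NNReal.smul_def, smul_smul]
    rw [mul_inv_cancel₀ this, one_smul]
  have hhb : MemLp h 2 μ := by
    refine MemLp.of_bound hhm 1 (ae_of_all _ fun x => ?_)
    have hp : (0 : ℝ) < w x := by exact_mod_cast (hwpos x)
    simp only [hh, norm_smul, norm_inv, Real.norm_of_nonneg hp.le]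
    rw [inv_mul_le_one₀ hp]
    simp [hw]
  have hmul : ∀ E : α → 𝕜, ∫ x, E x * h x ∂μ = ∫ x, E x * g x ∂ν := fun E => by
    rw [hμ, integral_withDensity_eq_integral_smul hwm]
    refine integral_congr_ae ?_
    filter_upwards [hgg'] with x hx
    change w x • (E x * h x) = E x * g x
    rw [← mul_smul_comm, hwh, hx]
  obtain ⟨R, hR⟩ : ∃ R : ℝ, ∀ᵐ x ∂ν, ‖F x‖ ≤ R := by
    refine ⟨(eLpNorm F ⊤ ν).toReal, ?_⟩
    filter_upwards [ae_le_eLpNormEssSup (f := F) (μ := ν)] with x hx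
    rw [← eLpNorm_exponent_top] at hx
    simpa using ENNReal.toReal_mono hF.2.ne hx
  have key := tendsto_integral_mul_of_tailTrivial (G := fun n x => F (T^[n] x)) (R := R) hμν hνμ hT
    htriv hhb (by simpa [h0] using hmul fun _ => 1) ?_ ?_
  · simpa only [hmul] using key
  · intro n
    obtain ⟨F', hF'm, hFF'⟩ := hF.1
    refine ⟨F' ∘ T^[n], hF'm.comp_measurable (comap_measurable _), ?_⟩
    exact hμν.ae_eq ((hT.iterate n).quasiMeasurePreserving.ae_eq_comp hFF')
  · intro n
    exact hμν.ae_le ((hT.iterate n).quasiMeasurePreserving.ae hR)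

end Abstract

section Averages

variable {𝕜 : Type*} [RCLike 𝕜]

lemma tendsto_boxAvg_zero {D : ℝ → ℝ} (hDm : AEStronglyMeasurable D leb) {R : ℝ}
    (hR : ∀ᵐ x ∂leb, |D x| ≤ R) (hD : Tendsto D atTop (𝓝 0)) : HasAvg D 0 := by
  have hint : ∀ a : ℝ, IntegrableOn D (Ioc 0 a) := fun a => by
    have hsub : Ioc (0 : ℝ) a ⊆ Ioi 0 := Ioc_subset_Ioi_self
    refine IntegrableOn.of_bound measure_Ioc_lt_top
      (hDm.mono_measure (Measure.restrict_mono hsub le_rfl)) R ?_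
    exact ae_mono (Measure.restrict_mono hsub le_rfl) hR
  rw [HasAvg, Metric.tendsto_atTop]
  intro ε hε
  obtain ⟨r₀, hr₀⟩ := Metric.tendsto_atTop.1 hD (ε / 2) (by positivity)
  set r := max r₀ 1 with hr
  set J := |∫ x in Ioc 0 r, D x| with hJ
  refine ⟨max r (2 * J / ε + 1), fun a ha => ?_⟩
  have hra : r ≤ a := (le_max_left _ _).trans ha
  have hr1 : 0 < r := lt_of_lt_of_le one_pos (le_max_right _ _)
  have ha0 : 0 < a := hr1.trans_le hra
  have hJa : 2 * J / ε < a := by linarith [(le_max_right r (2 * J / ε + 1)).trans ha]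
  have hsplit : ∫ x in Ioc 0 a, D x = (∫ x in Ioc 0 r, D x) + ∫ x in Ioc r a, D x := by
    rw [← setIntegral_union (Ioc_disjoint_Ioc_of_le le_rfl) measurableSet_Ioc (hint r)
      ((hint a).mono_set (Ioc_subset_Ioc_left hr1.le)), Ioc_union_Ioc_eq_Ioc hr1.le hra]
  have h2 : |∫ x in Ioc r a, D x| ≤ ε / 2 * (a - r) := by
    have := norm_setIntegral_le_of_norm_le_const (μ := volume) (s := Ioc r a) (f := D)
      (C := ε / 2) measure_Ioc_lt_top (fun x hx => by
        have := hr₀ x ((le_max_left _ _).trans hx.1.le)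
        rw [dist_zero_right] at this
        exact this.le)
    simpa [Real.volume_real_Ioc_of_le hra] using this
  rw [dist_zero_right, boxAvg, hsplit, smul_eq_mul, norm_mul, norm_inv, Real.norm_of_nonneg ha0.le,
    inv_mul_lt_iff₀ ha0]
  refine (norm_add_le _ _).trans_lt ?_
  rw [Real.norm_eq_abs, Real.norm_eq_abs, ← hJ]
  rw [div_lt_iff₀ hε] at hJa
  nlinarith

lemma hasAvg_sin : HasAvg Real.sin 0 := by
  have : ∀ᶠ a : ℝ in atTop, boxAvg Real.sin a = a⁻¹ * (1 - Real.cos a) := by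
    filter_upwards [eventually_ge_atTop 0] with a ha
    rw [boxAvg, ← intervalIntegral.integral_of_le ha, integral_sin]
    simp
  rw [HasAvg, tendsto_congr' this]
  refine tendsto_inv_atTop_zero.zero_mul_isBoundedUnder_le ?_
  refine isBoundedUnder_of ⟨2, fun a => ?_⟩
  simp only [Function.comp_apply, Real.norm_eq_abs, abs_le]
  constructor <;> linarith [Real.neg_one_le_cos a, Real.cos_le_one a]

lemma hasAvg_sin_sq : HasAvg (fun x => Real.sin x * Real.sin x) (1 / 2 : ℝ) := by
  have : ∀ᶠ a : ℝ in atTop, boxAvg (fun x => Real.sin x * Real.sin x) a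
      = 1 / 2 - a⁻¹ * (Real.sin a * Real.cos a / 2) := by
    filter_upwards [eventually_gt_atTop 0] with a ha
    rw [boxAvg, ← intervalIntegral.integral_of_le ha.le]
    simp only [← pow_two, integral_sin_sq]
    simp
    field_simp
    ring
  rw [HasAvg, tendsto_congr' this]
  have : Tendsto (fun a : ℝ => a⁻¹ * (Real.sin a * Real.cos a / 2)) atTop (𝓝 0) := by
    refine tendsto_inv_atTop_zero.zero_mul_isBoundedUnder_le ?_
    refine isBoundedUnder_of ⟨1, fun a => ?_⟩
    simp only [Function.comp_apply, Real.norm_eq_abs, abs_div, abs_mul]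
    have h1 := Real.abs_sin_le_one a
    have h2 := Real.abs_cos_le_one a
    have := mul_le_one₀ h1 (abs_nonneg _) h2
    norm_num
    linarith
  have h2 := this.const_sub (1 / 2)
  rwa [sub_zero] at h2

lemma HasAvg.ofReal {f : ℝ → ℝ} {ℓ : ℝ} (h : HasAvg f ℓ) :
    HasAvg (fun x => (f x : 𝕜)) (ℓ : 𝕜) := by
  have : boxAvg (fun x => (f x : 𝕜)) = fun a => ((boxAvg f a : ℝ) : 𝕜) := by
    funext a
    simp only [boxAvg]
    rw [integral_ofReal, RCLike.real_smul_eq_coe_mul, smul_eq_mul, RCLike.ofReal_mul]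
  rw [HasAvg, this]
  exact (RCLike.continuous_ofReal.tendsto ℓ).comp h

lemma HasAvg.add {f g : ℝ → ℝ} {ℓ ℓ' : ℝ} (hf : HasAvg f ℓ) (hg : HasAvg g ℓ')
    (hfi : ∀ a, IntegrableOn f (Ioc 0 a)) (hgi : ∀ a, IntegrableOn g (Ioc 0 a)) :
    HasAvg (fun x => f x + g x) (ℓ + ℓ') := by
  have : boxAvg (fun x => f x + g x) = fun a => boxAvg f a + boxAvg g a := by
    funext a
    simp only [boxAvg]
    rw [integral_add (hfi a) (hgi a), smul_add]
  rw [HasAvg, this]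
  exact Tendsto.add hf hg

lemma memLp_sin : MemLp (fun x => ((Real.sin x : ℝ) : 𝕜)) ⊤ leb := by
  refine memLp_top_of_bound (C := 1) ?_ (ae_of_all _ fun x => ?_)
  · exact (RCLike.continuous_ofReal.comp Real.continuous_sin).aestronglyMeasurable
  · simpa using Real.abs_sin_le_one x

lemma isGlobal_sin : IsGlobal (fun x => ((Real.sin x : ℝ) : 𝕜)) :=
  ⟨memLp_sin, _, hasAvg_sin.ofReal⟩

/-- A measurable map asymptotic to the identity at infinity does not decorrelate `sin`. -/
lemma hasAvg_sin_comp_mul_sin {S : ℝ → ℝ} (hSm : AEMeasurable S leb)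
    (hS : Tendsto (fun x => S x - x) atTop (𝓝 0)) :
    HasAvg (fun x => Real.sin (S x) * Real.sin x) (1 / 2 : ℝ) := by
  set D : ℝ → ℝ := fun x => (Real.sin (S x) - Real.sin x) * Real.sin x with hD
  have hDm : AEStronglyMeasurable D leb := by
    refine AEMeasurable.aestronglyMeasurable ?_
    exact ((Real.measurable_sin.comp_aemeasurable hSm).sub Real.measurable_sin.aemeasurable).mul
      Real.measurable_sin.aemeasurable
  have hDb : ∀ x, |D x| ≤ 2 := fun x => by
    rw [hD, abs_mul]
    have h1 : |Real.sin (S x) - Real.sin x| ≤ 2 := (abs_sub _ _).trans (by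
      linarith [Real.abs_sin_le_one (S x), Real.abs_sin_le_one x])
    exact (mul_le_mul h1 (Real.abs_sin_le_one x) (abs_nonneg _) two_pos.le).trans_eq (mul_one _)
  have hDlim : Tendsto D atTop (𝓝 0) := by
    refine squeeze_zero_norm (a := fun x => |S x - x|) (fun x => ?_) (by simpa using hS.abs)
    rw [hD, norm_mul, Real.norm_eq_abs, Real.norm_eq_abs]
    have h1 : |Real.sin (S x) - Real.sin x| ≤ |S x - x| := by
      simpa [Real.dist_eq] using Real.lipschitzWith_sin.dist_le_mul (S x) x
    calc _ ≤ |S x - x| * 1 := by gcongr; exact Real.abs_sin_le_one x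
      _ = _ := mul_one _
  have hs : ∀ a, IntegrableOn (fun x => Real.sin x * Real.sin x) (Ioc 0 a) := fun a =>
    (Real.continuous_sin.mul Real.continuous_sin).integrableOn_Ioc
  have hDi : ∀ a, IntegrableOn D (Ioc 0 a) := fun a =>
    IntegrableOn.of_bound measure_Ioc_lt_top
      (hDm.mono_measure (Measure.restrict_mono Ioc_subset_Ioi_self le_rfl)) 2 (ae_of_all _ hDb)
  have := hasAvg_sin_sq.add (tendsto_boxAvg_zero hDm (ae_of_all _ hDb) hDlim) hs hDi
  rw [add_zero] at this
  convert this using 2 with x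
  rw [hD]; ring

end Averages

section Negative

variable (𝕜 : Type*) [RCLike 𝕜] {T : ℝ → ℝ}

lemma tendsto_iterate_sub_self (hT : Tendsto (fun x => T x - x) atTop (𝓝 0)) (n : ℕ) :
    Tendsto (fun x => T^[n] x - x) atTop (𝓝 0) := by
  have hTtop : Tendsto T atTop atTop := by
    have := hT.add_atTop tendsto_id
    simpa using this
  induction n with
  | zero => simp
  | succ n ih =>
    have := (ih.comp hTtop).add hT
    rw [add_zero] at this
    refine this.congr fun x => ?_
    simp [Function.iterate_succ_apply]

lemma hasAvg_sin_iterate (hTm : ∀ n : ℕ, AEMeasurable (T^[n]) leb)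
    (hT : Tendsto (fun x => T x - x) atTop (𝓝 0)) (n : ℕ) :
    HasAvg (fun x => ((Real.sin (T^[n] x) : ℝ) : 𝕜) * ((Real.sin x : ℝ) : 𝕜))
      ((1 / 2 : ℝ) : 𝕜) := by
  have := (hasAvg_sin_comp_mul_sin (hTm n) (tendsto_iterate_sub_self hT n)).ofReal (𝕜 := 𝕜)
  simpa only [RCLike.ofReal_mul] using this

lemma not_weakGGM1 (hTm : ∀ n : ℕ, AEMeasurable (T^[n]) leb)
    (hT : Tendsto (fun x => T x - x) atTop (𝓝 0)) : ¬ WeakGGM1 𝕜 T := by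
  intro h
  have := h _ _ _ _ isGlobal_sin isGlobal_sin hasAvg_sin.ofReal hasAvg_sin.ofReal _
    (hasAvg_sin_iterate 𝕜 hTm hT)
  have := tendsto_nhds_unique this tendsto_const_nhds
  rw [← RCLike.ofReal_mul, RCLike.ofReal_inj] at this
  norm_num at this

lemma not_GGM1 (hTm : ∀ n : ℕ, AEMeasurable (T^[n]) leb)
    (hT : Tendsto (fun x => T x - x) atTop (𝓝 0)) : ¬ GGM1 𝕜 T := by
  intro h
  obtain ⟨A, hA, hlim⟩ := h _ _ _ _ isGlobal_sin isGlobal_sin hasAvg_sin.ofReal hasAvg_sin.ofReal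
  have hA' : ∀ᶠ n in atTop, A n = ((1 / 2 : ℝ) : 𝕜) := by
    filter_upwards [hA] with n hn
    exact tendsto_nhds_unique hn (hasAvg_sin_iterate 𝕜 hTm hT n)
  have := tendsto_nhds_unique hlim (tendsto_const_nhds.congr' (hA'.mono fun _ h => h.symm))
  rw [← RCLike.ofReal_mul, RCLike.ofReal_inj] at this
  norm_num at this

lemma exists_lt_norm_boxAvg_sin (hTm : ∀ n : ℕ, AEMeasurable (T^[n]) leb)
    (hT : Tendsto (fun x => T x - x) atTop (𝓝 0)) (n : ℕ) :
    ∀ᶠ a in atTop,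
      1 / 4 < ‖boxAvg (fun x => ((Real.sin (T^[n] x) : ℝ) : 𝕜) * ((Real.sin x : ℝ) : 𝕜)) a‖ := by
  refine (hasAvg_sin_iterate 𝕜 hTm hT n).norm.eventually_const_lt ?_
  rw [RCLike.norm_ofReal, abs_of_pos] <;> norm_num

lemma not_GGM2 (hTm : ∀ n : ℕ, AEMeasurable (T^[n]) leb)
    (hT : Tendsto (fun x => T x - x) atTop (𝓝 0)) : ¬ GGM2 𝕜 T := by
  intro h
  obtain ⟨M, -, hM⟩ := h _ _ _ _ isGlobal_sin isGlobal_sin hasAvg_sin.ofReal hasAvg_sin.ofReal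
    (1 / 4) (by norm_num)
  obtain ⟨n, hn⟩ := exists_nat_ge M
  obtain ⟨a, ha, haM⟩ := ((exists_lt_norm_boxAvg_sin 𝕜 hTm hT n).and
    (eventually_ge_atTop M)).exists
  have := hM a haM n hn
  simp only [RCLike.ofReal_zero, mul_zero, sub_zero] at this
  linarith

lemma not_GLM3 (hTm : ∀ n : ℕ, AEMeasurable (T^[n]) leb)
    (hT : Tendsto (fun x => T x - x) atTop (𝓝 0)) : ¬ GLM3 𝕜 T := by
  intro h
  have hlim := h _ _ isGlobal_sin hasAvg_sin.ofReal
  obtain ⟨n, hn⟩ := (hlim.eventually_lt_const (u := ENNReal.ofReal (1 / 4))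
    (by simp)).exists
  obtain ⟨a, ha, ha0⟩ := ((exists_lt_norm_boxAvg_sin 𝕜 hTm hT n).and
    (eventually_gt_atTop 0)).exists
  set s : ℝ → 𝕜 := fun x => ((Real.sin x : ℝ) : 𝕜) with hs
  have hsc : Continuous s := RCLike.continuous_ofReal.comp Real.continuous_sin
  set g : ℝ → 𝕜 := (Ioc 0 a).indicator s with hg
  have hsub : Ioc (0 : ℝ) a ∩ Ioi 0 = Ioc 0 a := inter_eq_left.2 Ioc_subset_Ioi_self
  have hgl : IsLocal g := by
    rw [IsLocal, hg, integrable_indicator_iff measurableSet_Ioc, IntegrableOn, leb,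
      Measure.restrict_restrict measurableSet_Ioc, hsub]
    exact hsc.integrableOn_Ioc
  have hint : ∫ x, s (T^[n] x) * g x ∂leb = a • boxAvg (fun x => s (T^[n] x) * s x) a := by
    rw [boxAvg, smul_inv_smul₀ ha0.ne', ← hsub, ← Measure.restrict_restrict measurableSet_Ioc,
      ← integral_indicator measurableSet_Ioc]
    refine integral_congr_ae (ae_of_all _ fun x => ?_)
    by_cases hx : x ∈ Ioc 0 a <;> simp [hg, hx]
  have hle : ∫ x, ‖g x‖ ∂leb ≤ a := by
    have h1 : (fun x => ‖g x‖) = (Ioc 0 a).indicator fun x => ‖s x‖ := by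
      funext x
      by_cases hx : x ∈ Ioc 0 a <;> simp [hg, hx]
    rw [h1, integral_indicator measurableSet_Ioc, leb,
      Measure.restrict_restrict measurableSet_Ioc, hsub]
    have := norm_setIntegral_le_of_norm_le_const (μ := volume) (s := Ioc 0 a)
      (f := fun x => ‖s x‖) (C := 1) measure_Ioc_lt_top (fun x _ => by
        simpa [hs] using Real.abs_sin_le_one x)
    rw [Real.volume_real_Ioc_of_le ha0.le, one_mul, sub_zero] at this
    exact (le_abs_self _).trans this
  have hbig : a * (1 / 4) < ‖∫ x, s (T^[n] x) * g x ∂leb‖ := by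
    rw [hint, norm_smul, Real.norm_of_nonneg ha0.le]
    gcongr
  have hpos : 0 < ∫ x, ‖g x‖ ∂leb := by
    have h1 : ‖∫ x, s (T^[n] x) * g x ∂leb‖ ≤ ∫ x, ‖g x‖ ∂leb := by
      refine norm_integral_le_of_norm_le hgl.norm (ae_of_all _ fun x => ?_)
      rw [norm_mul]
      refine mul_le_of_le_one_left (norm_nonneg _) ?_
      simpa [hs] using Real.abs_sin_le_one _
    nlinarith
  refine absurd hn (not_lt.2 ?_)
  refine le_trans ?_ (le_iSup₂_of_le g hgl (le_iSup_of_le hpos.ne' le_rfl))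
  refine ENNReal.ofReal_le_ofReal ?_
  rw [RCLike.ofReal_zero, zero_mul, sub_zero, le_div_iff₀ hpos]
  change _ ≤ ‖∫ x, s (T^[n] x) * g x ∂leb‖
  linarith

end Negative

lemma isOpen_interval (a : ℕ → ℝ) (j : ℕ) : IsOpen (interval a j) := by
  cases j with
  | zero => exact isOpen_Ioi
  | succ j => exact isOpen_Ioo

lemma measurableSet_interval (a : ℕ → ℝ) (j : ℕ) : MeasurableSet (interval a j) :=
  (isOpen_interval a j).measurableSet

namespace IsPartition

variable {N : ℕ∞} {a : ℕ → ℝ}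

lemma zero_le_one (h : IsPartition N a) : 0 ≤ a 1 := h.nonneg 1 le_rfl (by simpa using h.one_le)

lemma zero_lt (h : IsPartition N a) : ((0 : ℕ) : ℕ∞) < N :=
  lt_of_lt_of_le (by simp) h.one_le

lemma interval_succ_subset (h : IsPartition N a) {j : ℕ} (hj : ((j + 1 : ℕ) : ℕ∞) < N) :
    interval a (j + 1) ⊆ Ioo 0 (a 1) := by
  have hle : ∀ i : ℕ, ((i + 1 : ℕ) : ℕ∞) ≤ N → a (i + 1) ≤ a 1 := by
    intro i
    induction i with
    | zero => intro _; exact le_rfl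
    | succ i ih =>
      intro hi
      exact (h.strictAnti (i + 1) (by omega) hi).le.trans
        (ih (le_trans (by exact_mod_cast Nat.le_succ _) hi))
  have hj2 : ((j + 1 + 1 : ℕ) : ℕ∞) ≤ N := by
    rw [Nat.cast_add (j + 1) 1]
    exact Order.add_one_le_of_lt hj
  rintro x ⟨h1, h2⟩
  exact ⟨(h.nonneg (j + 2) (by omega) hj2).trans_lt h1, h2.trans_le (hle j hj.le)⟩

lemma interval_subset (h : IsPartition N a) {j : ℕ} (hj : (j : ℕ∞) < N) :
    interval a j ⊆ Ioi 0 := by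
  cases j with
  | zero => exact fun x hx => h.zero_le_one.trans_lt hx
  | succ j => exact fun x hx => (h.interval_succ_subset hj hx).1

/-- Up to the end points the intervals cover the half-line. -/
lemma exists_mem_interval (h : IsPartition N a) {x : ℝ} (hx : 0 < x) (hxa : x ∉ range a) :
    ∃ j : ℕ, (j : ℕ∞) < N ∧ x ∈ interval a j := by
  classical
  have hex : ∃ k : ℕ, 1 ≤ k ∧ (k : ℕ∞) ≤ N ∧ a k < x := by
    induction N using ENat.recTopCoe with
    | top =>
      obtain ⟨k, hk, hk1⟩ := (((h.lim rfl).eventually_lt_const hx).and (eventually_ge_atTop 1)).exists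
      exact ⟨k, hk1, le_top, hk⟩
    | coe n =>
      refine ⟨n, by exact_mod_cast h.one_le, le_rfl, ?_⟩
      rw [h.last n rfl]; exact hx
  obtain ⟨hk1, hkN, hkx⟩ := Nat.find_spec hex
  have hmin := fun m hm => Nat.find_min (m := m) hex hm
  generalize Nat.find hex = k at *
  obtain ⟨k, rfl⟩ : ∃ i, k = i + 1 := ⟨k - 1, by omega⟩
  have hkN' : (k : ℕ∞) < N := lt_of_lt_of_le (by exact_mod_cast Nat.lt_succ_self k) hkN
  refine ⟨k, hkN', ?_⟩
  cases k with
  | zero => exact hkx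
  | succ k =>
    refine ⟨hkx, lt_of_le_of_ne ?_ fun hh => hxa ⟨_, hh.symm⟩⟩
    by_contra! hlt
    exact hmin (k + 1) (by omega) ⟨by omega, hkN'.le, hlt⟩

end IsPartition

namespace IsIntermittent

variable {T : ℝ → ℝ} {N : ℕ∞} {a : ℕ → ℝ} {τ : ℕ → ℝ → ℝ}

lemma contDiffOn_interval (hT : IsIntermittent T N a τ) {j : ℕ} (hj : (j : ℕ∞) < N) :
    ContDiffOn ℝ 2 (τ j) (interval a j) := by
  cases j with
  | zero => exact hT.contDiffOn_zero.mono Ioi_subset_Ici_self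
  | succ j =>
    rcases hT.contDiffOn (j + 1) (by omega) hj with h | h
    · exact h.mono Ioo_subset_Ico_self
    · exact h.mono Ioo_subset_Ioc_self

lemma hasStrictDerivAt (hT : IsIntermittent T N a τ) {j : ℕ} (hj : (j : ℕ∞) < N) {x : ℝ}
    (hx : x ∈ interval a j) : HasStrictDerivAt (τ j) (deriv (τ j) x) x :=
  ((hT.contDiffOn_interval hj).contDiffAt ((isOpen_interval a j).mem_nhds hx)).hasStrictDerivAt
    (by norm_num)

lemma hasDerivAt_deriv (hT : IsIntermittent T N a τ) {j : ℕ} (hj : (j : ℕ∞) < N) {x : ℝ}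
    (hx : x ∈ interval a j) : HasDerivAt (deriv (τ j)) (deriv (deriv (τ j)) x) x := by
  have h : ContDiffOn ℝ 1 (deriv (τ j)) (interval a j) :=
    (hT.contDiffOn_interval hj).deriv_of_isOpen (isOpen_interval a j) (by norm_num)
  exact ((h.differentiableOn (by norm_num)).differentiableAt
    ((isOpen_interval a j).mem_nhds hx)).hasDerivAt

section Displacement

/-- The displacement `u(x) = x - τ₀(x)`. -/
def disp (τ : ℕ → ℝ → ℝ) : ℝ → ℝ := fun x => x - τ 0 x

lemma hasDerivAt_disp (hT : IsIntermittent T N a τ) {x : ℝ} (hx : a 1 < x) :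
    HasDerivAt (disp τ) (1 - deriv (τ 0) x) x :=
  (hasDerivAt_id x).sub (hT.hasStrictDerivAt hT.partition.zero_lt hx).hasDerivAt

lemma deriv_disp (hT : IsIntermittent T N a τ) {x : ℝ} (hx : a 1 < x) :
    deriv (disp τ) x = 1 - deriv (τ 0) x := (hT.hasDerivAt_disp hx).deriv

lemma deriv_deriv_disp (hT : IsIntermittent T N a τ) {x : ℝ} (hx : a 1 < x) :
    deriv (deriv (disp τ)) x = - deriv (deriv (τ 0)) x := by
  have h1 : deriv (disp τ) =ᶠ[𝓝 x] fun y => 1 - deriv (τ 0) y := by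
    filter_upwards [isOpen_Ioi.mem_nhds hx] with y hy using hT.deriv_disp hy
  rw [h1.deriv_eq, deriv_const_sub]

lemma convexOn_disp (hT : IsIntermittent T N a τ) : ConvexOn ℝ (Ioi (a 1)) (disp τ) :=
  hT.u_convex.subset Ioi_subset_Ici_self (convex_Ioi _)

lemma disp_pos (hT : IsIntermittent T N a τ) {x : ℝ} (hx : a 1 < x) : 0 < disp τ x :=
  hT.u_pos x hx

/-- The tangent lines lie below the graph of the displacement. -/
lemma disp_sub_le (hT : IsIntermittent T N a τ) {x y : ℝ} (hx : a 1 < x) (hxy : x ≤ y) :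
    disp τ x - disp τ y ≤ (deriv (τ 0) x - 1) * (y - x) := by
  rcases hxy.eq_or_lt with rfl | hlt
  · simp
  have := hT.convexOn_disp.le_slope_of_hasDerivAt hx (hx.trans hlt) hlt (hT.hasDerivAt_disp hx)
  rw [slope_def_field, le_div_iff₀ (sub_pos.2 hlt)] at this
  linarith

lemma one_le_deriv (hT : IsIntermittent T N a τ) {x : ℝ} (hx : a 1 < x) :
    1 ≤ deriv (τ 0) x := by
  by_contra! hlt
  have h1 : Tendsto (fun y => disp τ x + (1 - deriv (τ 0) x) * (y - x)) atTop atTop := by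
    refine tendsto_atTop_add_const_left _ _ ?_
    exact Tendsto.const_mul_atTop (by linarith) (tendsto_atTop_add_const_right _ _ tendsto_id)
  have h2 : Tendsto (disp τ) atTop atTop := by
    refine tendsto_atTop_mono' _ ?_ h1
    filter_upwards [eventually_ge_atTop x] with y hy
    have := hT.disp_sub_le hx hy
    linarith
  exact not_tendsto_nhds_of_tendsto_atTop h2 0 hT.u_tendsto

lemma disp_antitone (hT : IsIntermittent T N a τ) {x y : ℝ} (hx : a 1 < x) (hxy : x ≤ y) :
    disp τ y ≤ disp τ x := by
  rcases hxy.eq_or_lt with rfl | hlt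
  · exact le_rfl
  have := hT.convexOn_disp.slope_le_of_hasDerivAt hx (hx.trans hlt) hlt
    (hT.hasDerivAt_disp (hx.trans hlt))
  rw [slope_def_field, div_le_iff₀ (sub_pos.2 hlt)] at this
  nlinarith [hT.one_le_deriv (hx.trans hlt)]

lemma deriv_antitone (hT : IsIntermittent T N a τ) {x y : ℝ} (hx : a 1 < x) (hxy : x ≤ y) :
    deriv (τ 0) y ≤ deriv (τ 0) x := by
  have := hT.convexOn_disp.monotoneOn_deriv
    (fun z hz => (hT.hasDerivAt_disp hz).differentiableAt) hx (hx.trans_le hxy) hxy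
  rw [hT.deriv_disp hx, hT.deriv_disp (hx.trans_le hxy)] at this
  linarith

lemma deriv_deriv_nonpos (hT : IsIntermittent T N a τ) {x : ℝ} (hx : a 1 < x) :
    deriv (deriv (τ 0)) x ≤ 0 := by
  have h1 : AntitoneOn (deriv (τ 0)) (Ioi (a 1)) := fun y hy z _ hyz => hT.deriv_antitone hy hyz
  have h2 := h1.derivWithin_nonpos (x := x)
  rwa [derivWithin_of_mem_nhds (isOpen_Ioi.mem_nhds hx)] at h2

lemma deriv_deriv_mono (hT : IsIntermittent T N a τ) {x y : ℝ} (hx : a 1 < x) (hxy : x ≤ y) :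
    deriv (deriv (τ 0)) x ≤ deriv (deriv (τ 0)) y := by
  have := hT.u_deriv2 hx (hx.trans_le hxy) hxy
  change deriv (deriv (disp τ)) y ≤ deriv (deriv (disp τ)) x at this
  rw [hT.deriv_deriv_disp hx, hT.deriv_deriv_disp (hx.trans_le hxy)] at this
  linarith

lemma neg_deriv_deriv_mul_le (hT : IsIntermittent T N a τ) {x y : ℝ} (hx : a 1 < x)
    (hxy : x ≤ y) : -deriv (deriv (τ 0)) y * (y - x) ≤ deriv (τ 0) x - deriv (τ 0) y := by
  rcases hxy.eq_or_lt with rfl | hlt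
  · simp
  have hd : ∀ z, a 1 < z → HasDerivAt (deriv (τ 0)) (deriv (deriv (τ 0)) z) z := fun z hz =>
    hT.hasDerivAt_deriv hT.partition.zero_lt hz
  obtain ⟨c, hc, hcs⟩ := exists_deriv_eq_slope (deriv (τ 0)) hlt
    (fun z hz => (hd z (hx.trans_le hz.1)).continuousAt.continuousWithinAt)
    (fun z hz => (hd z (hx.trans hz.1)).differentiableAt.differentiableWithinAt)
  have h1 := hT.deriv_deriv_mono (hx.trans hc.1) hc.2.le
  rw [hcs, div_le_iff₀ (sub_pos.2 hlt)] at h1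
  linarith

lemma exists_deriv_le (hT : IsIntermittent T N a τ) :
    ∃ P : ℝ, ∀ x, a 1 < x → deriv (τ 0) x ≤ P := by
  have hc : ContinuousOn (derivWithin (τ 0) (Ici (a 1))) (Ici (a 1)) :=
    hT.contDiffOn_zero.continuousOn_derivWithin (uniqueDiffOn_Ici _) (by norm_num)
  have ht : Tendsto (derivWithin (τ 0) (Ici (a 1))) (𝓝[>] (a 1))
      (𝓝 (derivWithin (τ 0) (Ici (a 1)) (a 1))) :=
    (hc (a 1) self_mem_Ici).mono_left (nhdsWithin_mono _ Ioi_subset_Ici_self)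
  refine ⟨_, fun x hx => ge_of_tendsto ht ?_⟩
  filter_upwards [Ioo_mem_nhdsGT hx] with y hy
  rw [derivWithin_of_mem_nhds (Ici_mem_nhds hy.1)]
  exact hT.deriv_antitone hy.1 hy.2.le

end Displacement

end IsIntermittent

/-- The inverse of the branch of `T` on the `j`-th interval. -/
noncomputable def branchInv (T : ℝ → ℝ) (a : ℕ → ℝ) (j : ℕ) : ℝ → ℝ :=
  Function.invFunOn T (interval a j)

/-- `ψ` is a right inverse of `T^[m]` on the half-line with derivative `ω`, and the logarithmic
derivative of `ω` is bounded by `φ`. -/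
structure IsInvIterate (T φ : ℝ → ℝ) (m : ℕ) (ψ ω : ℝ → ℝ) : Prop where
  pos : ∀ t, 0 < t → 0 < ψ t
  rightInv : ∀ t, 0 < t → T^[m] (ψ t) = t
  hasDerivAt : ∀ t, 0 < t → HasDerivAt ψ (ω t) t
  ne_zero : ∀ t, 0 < t → ω t ≠ 0
  distortion : ∀ t, 0 < t → ∃ θ, HasDerivAt ω θ t ∧ |θ| ≤ φ t * |ω t|

lemma IsInvIterate.abs_le_exp_mul {T φ : ℝ → ℝ} {m : ℕ} {ψ ω : ℝ → ℝ} (h : IsInvIterate T φ m ψ ω)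
    {M D : ℝ} (hD : ∀ t ∈ Ioc 0 M, φ t ≤ D) (hD0 : 0 ≤ D) {t t' : ℝ} (ht : t ∈ Ioc 0 M)
    (ht' : t' ∈ Ioc 0 M) : |ω t| ≤ Real.exp (D * M) * |ω t'| := by
  choose! θ hθ hθ' using h.distortion
  have hlog : ∀ s ∈ Ioc 0 M,
      HasDerivWithinAt (fun s => Real.log (ω s)) (θ s / ω s) (Ioc 0 M) s := fun s hs =>
    ((hθ s hs.1).log (h.ne_zero s hs.1)).hasDerivWithinAt
  have hb : ∀ s ∈ Ioc 0 M, ‖θ s / ω s‖ ≤ D := fun s hs => by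
    have hp := abs_pos.2 (h.ne_zero s hs.1)
    rw [norm_div, Real.norm_eq_abs, Real.norm_eq_abs, div_le_iff₀ hp]
    exact (hθ' s hs.1).trans (by gcongr; exact hD s hs)
  have key := (convex_Ioc 0 M).norm_image_sub_le_of_norm_hasDerivWithin_le hlog hb ht' ht
  have hd : |t - t'| ≤ M := by
    rw [_root_.abs_le]; constructor <;> linarith [ht.1, ht.2, ht'.1, ht'.2]
  have h1 : Real.log (ω t) ≤ D * M + Real.log (ω t') := by
    have : D * ‖t - t'‖ ≤ D * M := by gcongr; exact hd
    have := (le_abs_self _).trans (key.trans this)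
    linarith
  calc |ω t| = Real.exp (Real.log (ω t)) := (Real.exp_log_eq_abs (h.ne_zero t ht.1)).symm
    _ ≤ Real.exp (D * M + Real.log (ω t')) := Real.exp_le_exp.2 h1
    _ = _ := by rw [Real.exp_add, Real.exp_log_eq_abs (h.ne_zero t' ht'.1)]

namespace IsIntermittent

variable {T : ℝ → ℝ} {N : ℕ∞} {a : ℕ → ℝ} {τ : ℕ → ℝ → ℝ}

lemma branchInv_mem (hT : IsIntermittent T N a τ) {j : ℕ} (hj : (j : ℕ∞) < N) {t : ℝ}
    (ht : 0 < t) : branchInv T a j t ∈ interval a j :=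
  Function.invFunOn_mem ((hT.bijOn j hj).surjOn ht)

lemma apply_branchInv (hT : IsIntermittent T N a τ) {j : ℕ} (hj : (j : ℕ∞) < N) {t : ℝ}
    (ht : 0 < t) : T (branchInv T a j t) = t :=
  Function.invFunOn_eq ((hT.bijOn j hj).surjOn ht)

lemma branchInv_apply (hT : IsIntermittent T N a τ) {j : ℕ} (hj : (j : ℕ∞) < N) {x : ℝ}
    (hx : x ∈ interval a j) : branchInv T a j (T x) = x :=
  (hT.bijOn j hj).injOn.leftInvOn_invFunOn hx

lemma branchInv_pos (hT : IsIntermittent T N a τ) {j : ℕ} (hj : (j : ℕ∞) < N) {t : ℝ}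
    (ht : 0 < t) : 0 < branchInv T a j t :=
  hT.partition.interval_subset hj (hT.branchInv_mem hj ht)

lemma one_le_abs_deriv (hT : IsIntermittent T N a τ) {j : ℕ} (hj : (j : ℕ∞) < N) {x : ℝ}
    (hx : x ∈ interval a j) : 1 ≤ |deriv (τ j) x| := by
  cases j with
  | zero => exact (hT.one_le_deriv hx).trans (le_abs_self _)
  | succ j =>
    obtain ⟨Λ, h1, h2⟩ := hT.expanding
    exact h1.le.trans (h2 (j + 1) (by omega) hj x hx)

lemma deriv_ne_zero (hT : IsIntermittent T N a τ) {j : ℕ} (hj : (j : ℕ∞) < N) {x : ℝ}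
    (hx : x ∈ interval a j) : deriv (τ j) x ≠ 0 :=
  abs_pos.1 (one_pos.trans_le (hT.one_le_abs_deriv hj hx))

lemma hasDerivAt_branchInv (hT : IsIntermittent T N a τ) {j : ℕ} (hj : (j : ℕ∞) < N) {t : ℝ}
    (ht : 0 < t) :
    HasDerivAt (branchInv T a j) (deriv (τ j) (branchInv T a j t))⁻¹ t := by
  have hs := hT.branchInv_mem hj ht
  have h := (hT.hasStrictDerivAt hj hs).to_local_left_inverse (hT.deriv_ne_zero hj hs)
    (g := branchInv T a j) (by
      filter_upwards [(isOpen_interval a j).mem_nhds hs] with y hy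
      rw [hT.eqOn j hj hy, hT.branchInv_apply hj hy])
  rw [hT.eqOn j hj hs, hT.apply_branchInv hj ht] at h
  exact h.hasDerivAt

lemma hasDerivAt_inv_deriv_branchInv (hT : IsIntermittent T N a τ) {j : ℕ} (hj : (j : ℕ∞) < N)
    {t : ℝ} (ht : 0 < t) :
    HasDerivAt (fun t => (deriv (τ j) (branchInv T a j t))⁻¹)
      (-(deriv (deriv (τ j)) (branchInv T a j t) * (deriv (τ j) (branchInv T a j t))⁻¹) /
        deriv (τ j) (branchInv T a j t) ^ 2) t := by
  have hs := hT.branchInv_mem hj ht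
  exact ((hT.hasDerivAt_deriv hj hs).comp t (hT.hasDerivAt_branchInv hj ht)).inv
    (hT.deriv_ne_zero hj hs)

lemma isInvIterate_id {φ : ℝ → ℝ} (hφ : ∀ t, 0 < t → 0 ≤ φ t) :
    IsInvIterate T φ 0 id fun _ => 1 where
  pos _ h := h
  rightInv _ _ := rfl
  hasDerivAt t _ := hasDerivAt_id t
  ne_zero _ _ := one_ne_zero
  distortion t ht := ⟨0, hasDerivAt_const _ _, by simpa using hφ t ht⟩

lemma isInvIterate_comp (hT : IsIntermittent T N a τ) {φ ψ ω : ℝ → ℝ} {m j : ℕ}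
    (h : IsInvIterate T φ m ψ ω) (hj : (j : ℕ∞) < N)
    (hφ : ∀ t, 0 < t → φ (branchInv T a j t) * |deriv (τ j) (branchInv T a j t)|⁻¹ +
      |deriv (deriv (τ j)) (branchInv T a j t)| / |deriv (τ j) (branchInv T a j t)| ^ 2 ≤ φ t) :
    IsInvIterate T φ (m + 1) (ψ ∘ branchInv T a j)
      (fun t => ω (branchInv T a j t) * (deriv (τ j) (branchInv T a j t))⁻¹) where
  pos t ht := h.pos _ (hT.branchInv_pos hj ht)
  rightInv t ht := by
    rw [Function.iterate_succ_apply', Function.comp_apply, h.rightInv _ (hT.branchInv_pos hj ht),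
      hT.apply_branchInv hj ht]
  hasDerivAt t ht :=
    (h.hasDerivAt _ (hT.branchInv_pos hj ht)).comp t (hT.hasDerivAt_branchInv hj ht)
  ne_zero t ht := mul_ne_zero (h.ne_zero _ (hT.branchInv_pos hj ht))
    (inv_ne_zero (hT.deriv_ne_zero hj (hT.branchInv_mem hj ht)))
  distortion t ht := by
    obtain ⟨θ, hθ, hθ'⟩ := h.distortion _ (hT.branchInv_pos hj ht)
    refine ⟨_, (hθ.comp t (hT.hasDerivAt_branchInv hj ht)).mul
      (hT.hasDerivAt_inv_deriv_branchInv hj ht), ?_⟩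
    have hd := abs_pos.2 (hT.deriv_ne_zero hj (hT.branchInv_mem hj ht))
    have hφt := hφ t ht
    simp only [Function.comp_apply]
    set s := branchInv T a j t
    set d := deriv (τ j) s
    set e := deriv (deriv (τ j)) s
    refine (abs_add_le _ _).trans ?_
    simp only [abs_mul, abs_div, abs_neg, abs_inv, abs_pow]
    calc |θ| * |d|⁻¹ * |d|⁻¹ + |ω s| * (|e| * |d|⁻¹ / |d| ^ 2)
        ≤ φ s * |ω s| * |d|⁻¹ * |d|⁻¹ + |ω s| * (|e| * |d|⁻¹ / |d| ^ 2) := by gcongr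
      _ = (φ s * |d|⁻¹ + |e| / |d| ^ 2) * (|ω s| * |d|⁻¹) := by ring
      _ ≤ φ t * (|ω s| * |d|⁻¹) := by gcongr

lemma branchInv_zero_sub_disp (hT : IsIntermittent T N a τ) {t : ℝ} (ht : 0 < t) :
    branchInv T a 0 t - disp τ (branchInv T a 0 t) = t := by
  have h := hT.eqOn 0 hT.partition.zero_lt (hT.branchInv_mem hT.partition.zero_lt ht)
  rw [hT.apply_branchInv hT.partition.zero_lt ht] at h
  simp only [disp, h]
  ring

lemma branchInv_zero_mono (hT : IsIntermittent T N a τ) {t t' : ℝ} (ht : 0 < t) (htt' : t ≤ t') :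
    branchInv T a 0 t ≤ branchInv T a 0 t' := by
  by_contra! hlt
  have h0 : a 1 < branchInv T a 0 t' := hT.branchInv_mem hT.partition.zero_lt (ht.trans_le htt')
  have h1 := hT.disp_antitone h0 hlt.le
  linarith [hT.branchInv_zero_sub_disp ht, hT.branchInv_zero_sub_disp (ht.trans_le htt')]

/-- Existence of a locally bounded function that controls the distortion of all compositions of
inverse branches. -/
lemma exists_distortion_control (hT : IsIntermittent T N a τ) :
    ∃ φ : ℝ → ℝ, (∀ t, 0 < t → 0 ≤ φ t) ∧
      (∀ j : ℕ, (j : ℕ∞) < N → ∀ t, 0 < t →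
        φ (branchInv T a j t) * |deriv (τ j) (branchInv T a j t)|⁻¹ +
        |deriv (deriv (τ j)) (branchInv T a j t)| / |deriv (τ j) (branchInv T a j t)| ^ 2 ≤ φ t) ∧
      ∀ M, ∃ D, 0 ≤ D ∧ ∀ t ∈ Ioc 0 M, φ t ≤ D := by
  obtain ⟨K, hK, hdist⟩ := hT.distortion
  obtain ⟨Λ, hΛ, hexp⟩ := hT.expanding
  obtain ⟨P, hP⟩ := hT.exists_deriv_le
  have h0N := hT.partition.zero_lt
  have hmem : ∀ {t}, 0 < t → a 1 < branchInv T a 0 t := fun ht => hT.branchInv_mem h0N ht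
  set c : ℝ → ℝ := fun s => |deriv (deriv (τ 0)) s| / |deriv (τ 0) s| ^ 2 with hc
  set r : ℝ → ℝ := fun s => (deriv (τ 0) s - 1) / disp τ s with hr
  have hc0 : ∀ s, 0 ≤ c s := fun s => by positivity
  have hcK : ∀ s, a 1 < s → c s ≤ K := fun s hs => hdist 0 h0N s hs
  have hr0 : ∀ s, a 1 < s → 0 ≤ r s := fun s hs =>
    div_nonneg (by linarith [hT.one_le_deriv hs]) (hT.disp_pos hs).le
  have hrM : ∀ M, 0 < M → ∃ H, 0 ≤ H ∧ ∀ t ∈ Ioc 0 M, r (branchInv T a 0 t) ≤ H := by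
    intro M hM
    have hPM : 0 ≤ P - 1 := by linarith [hT.one_le_deriv (hmem hM), hP _ (hmem hM)]
    have hu := hT.disp_pos (hmem hM)
    refine ⟨(P - 1) / disp τ (branchInv T a 0 M), div_nonneg hPM hu.le, fun t ht => ?_⟩
    have h1 := hT.disp_antitone (hmem ht.1) (hT.branchInv_zero_mono ht.1 ht.2)
    have h2 := hP _ (hmem ht.1)
    simp only [hr]
    gcongr
  obtain ⟨H, hH0, hH⟩ : ∃ H, 0 ≤ H ∧ ∀ t ∈ Ioo 0 (a 1), r (branchInv T a 0 t) ≤ H := by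
    obtain ⟨H, h1, h2⟩ := hrM (max (a 1) 1) (by positivity)
    exact ⟨H, h1, fun t ht => h2 t ⟨ht.1, ht.2.le.trans (le_max_left _ _)⟩⟩
  set C := (Λ * K + K + H) / (Λ - 1) with hC
  have hΛ1 : 0 < Λ - 1 := by linarith
  have hC0 : 0 ≤ C := by positivity
  have hCeq : (K + H + C) * Λ⁻¹ + K = C := by
    rw [hC]; field_simp; ring
  refine ⟨fun t => c (branchInv T a 0 t) + r (branchInv T a 0 t) + C, ?_, ?_, ?_⟩
  · intro t ht
    have := hr0 _ (hmem ht)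
    have := hc0 (branchInv T a 0 t)
    positivity
  · intro j hj t ht
    cases j with
    | zero =>
      have hs1 := hmem ht
      have hst := hT.branchInv_zero_sub_disp ht
      set s1 := branchInv T a 0 t
      have hs10 : 0 < s1 := hT.partition.zero_le_one.trans_lt hs1
      have hs2 := hmem hs10
      have hst2 := hT.branchInv_zero_sub_disp hs10
      set s2 := branchInv T a 0 s1
      have hu1 := hT.disp_pos hs1
      have hu2 := hT.disp_pos hs2
      have hle : s1 ≤ s2 := by linarith
      have hd1 := hT.one_le_deriv hs1
      have hd2 := hT.one_le_deriv hs2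
      have htan := hT.disp_sub_le hs1 hle
      have hneg := hT.neg_deriv_deriv_mul_le hs1 hle
      have hdiff : s2 - s1 = disp τ s2 := by linarith
      rw [hdiff] at htan hneg
      have hce : c s2 ≤ -deriv (deriv (τ 0)) s2 := by
        rw [hc]
        simp only [abs_of_nonpos (hT.deriv_deriv_nonpos hs2)]
        refine div_le_self (by linarith [hT.deriv_deriv_nonpos hs2]) ?_
        exact one_le_pow₀ (hd2.trans (le_abs_self _))
      have hsum : c s2 + r s2 ≤ (deriv (τ 0) s1 - 1) / disp τ s2 := by
        rw [hr, le_div_iff₀ hu2, add_mul, div_mul_cancel₀ _ hu2.ne']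
        have := mul_le_mul_of_nonneg_right hce hu2.le
        linarith
      have hmain : (c s2 + r s2) * |deriv (τ 0) s1|⁻¹ ≤ r s1 := by
        rw [abs_of_pos (by linarith), ← div_eq_mul_inv, div_le_iff₀ (by linarith)]
        refine hsum.trans ?_
        rw [hr, div_mul_eq_mul_div, div_le_div_iff₀ hu2 hu1, mul_assoc]
        refine mul_le_mul_of_nonneg_left ?_ (by linarith)
        linarith
      have hCle : C * |deriv (τ 0) s1|⁻¹ ≤ C :=
        mul_le_of_le_one_right hC0 (inv_le_one_of_one_le₀ (hd1.trans (le_abs_self _)))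
      have hceq : |deriv (deriv (τ 0)) s1| / |deriv (τ 0) s1| ^ 2 = c s1 := rfl
      rw [hceq, add_mul]
      linarith
    | succ j =>
      have hs := hT.branchInv_mem hj ht
      have hs' := hT.partition.interval_succ_subset hj hs
      have h1 := hdist _ hj _ hs
      have h2 := hexp _ (by omega) hj _ hs
      set s := branchInv T a (j + 1) t
      have h3 := hcK _ (hmem hs'.1)
      have h4 := hH _ hs'
      have h5 := hr0 _ (hmem ht)
      have h6 := hc0 (branchInv T a 0 t)
      have h7 : (c (branchInv T a 0 s) + r (branchInv T a 0 s) + C) * |deriv (τ (j + 1)) s|⁻¹ ≤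
          (K + H + C) * Λ⁻¹ := by gcongr
      linarith
  · intro M
    obtain ⟨H', h1, h2⟩ := hrM (max M 1) (by positivity)
    refine ⟨K + H' + C, by positivity, fun t ht => ?_⟩
    have := h2 t ⟨ht.1, ht.2.trans (le_max_left _ _)⟩
    have := hcK _ (hmem ht.1)
    linarith

/-- Points whose orbit avoids the end points of the intervals are contained in the images of
arbitrarily contracting inverse branches of iterates. -/
lemma exists_isInvIterate (hT : IsIntermittent T N a τ) {φ : ℝ → ℝ}
    (hφ0 : ∀ t, 0 < t → 0 ≤ φ t)
    (hφ : ∀ j : ℕ, (j : ℕ∞) < N → ∀ t, 0 < t →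
      φ (branchInv T a j t) * |deriv (τ j) (branchInv T a j t)|⁻¹ +
      |deriv (deriv (τ j)) (branchInv T a j t)| / |deriv (τ j) (branchInv T a j t)| ^ 2 ≤ φ t)
    {Λ : ℝ} (hΛ : 1 < Λ)
    (hexp : ∀ j : ℕ, 1 ≤ j → (j : ℕ∞) < N → ∀ x ∈ interval a j, Λ ≤ |deriv (τ j) x|)
    {x : ℝ} (hx : 0 < x) (hxa : ∀ n : ℕ, T^[n] x ∉ range a) (k : ℕ) :
    ∃ (m : ℕ) (ψ ω : ℝ → ℝ), IsInvIterate T φ m ψ ω ∧ ψ (T^[m] x) = x ∧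
      T^[m] x ∈ Ioo 0 (a 1) ∧ |ω (T^[m] x)| ≤ Λ⁻¹ ^ k := by
  have hpos : ∀ n : ℕ, 0 < T^[n] x := fun n => hT.mapsTo.iterate n hx
  have hstep : ∀ {m j : ℕ} {ψ ω : ℝ → ℝ} {b : ℝ}, (j : ℕ∞) < N → T^[m] x ∈ interval a j →
      IsInvIterate T φ m ψ ω → ψ (T^[m] x) = x → |ω (T^[m] x)| ≤ b →
      ∃ ψ' ω' : ℝ → ℝ, IsInvIterate T φ (m + 1) ψ' ω' ∧ ψ' (T^[m + 1] x) = x ∧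
        |ω' (T^[m + 1] x)| ≤ b * |deriv (τ j) (T^[m] x)|⁻¹ := by
    intro m j ψ ω b hj hm hψ hψx hb
    refine ⟨_, _, hT.isInvIterate_comp hψ hj (hφ j hj), ?_, ?_⟩
    · rw [Function.iterate_succ_apply', Function.comp_apply, hT.branchInv_apply hj hm, hψx]
    · rw [Function.iterate_succ_apply', hT.branchInv_apply hj hm, abs_mul, abs_inv]
      gcongr
  have hreturn : ∀ {m : ℕ} {b : ℝ}, 0 ≤ b → (∃ ψ ω : ℝ → ℝ, IsInvIterate T φ m ψ ω ∧
      ψ (T^[m] x) = x ∧ |ω (T^[m] x)| ≤ b) →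
      ∃ m', T^[m'] x ∉ interval a 0 ∧ ∃ ψ ω : ℝ → ℝ, IsInvIterate T φ m' ψ ω ∧
      ψ (T^[m'] x) = x ∧ |ω (T^[m'] x)| ≤ b := by
    intro m b hb0 h
    by_contra! hcon
    have hall : ∀ i : ℕ, (∃ ψ ω : ℝ → ℝ, IsInvIterate T φ (m + i) ψ ω ∧
        ψ (T^[m + i] x) = x ∧ |ω (T^[m + i] x)| ≤ b) ∧ T^[m + i] x ∈ interval a 0 := by
      intro i
      induction i with
      | zero =>
        refine ⟨h, ?_⟩
        by_contra hnot
        obtain ⟨ψ, ω, h1, h2, h3⟩ := h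
        exact absurd h3 (not_le.2 (hcon _ hnot ψ ω h1 h2))
      | succ i ih =>
        obtain ⟨⟨ψ, ω, h1, h2, h3⟩, hi⟩ := ih
        obtain ⟨ψ', ω', h1', h2', h3'⟩ := hstep hT.partition.zero_lt hi h1 h2 h3
        have h4 : |ω' (T^[m + i + 1] x)| ≤ b := h3'.trans (mul_le_of_le_one_right hb0
          (inv_le_one_of_one_le₀ (hT.one_le_abs_deriv hT.partition.zero_lt hi)))
        refine ⟨⟨ψ', ω', h1', h2', h4⟩, ?_⟩
        by_contra hnot
        exact absurd h4 (not_le.2 (hcon _ hnot ψ' ω' h1' h2'))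
    have hx0 : a 1 < T^[m] x := (hall 0).2
    have hu := hT.disp_pos hx0
    have hdec : ∀ i : ℕ, T^[m + i] x ≤ T^[m] x - i * disp τ (T^[m] x) := by
      intro i
      induction i with
      | zero => simp
      | succ i ih =>
        have hi : a 1 < T^[m + i] x := (hall i).2
        have h1 : T^[m + (i + 1)] x = T^[m + i] x - disp τ (T^[m + i] x) := by
          rw [← add_assoc, Function.iterate_succ_apply',
            ← hT.eqOn 0 hT.partition.zero_lt hi, disp]
          ring
        have hle : T^[m + i] x ≤ T^[m] x := ih.trans (by
          have : 0 ≤ (i : ℝ) * disp τ (T^[m] x) := by positivity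
          linarith)
        have h2 := hT.disp_antitone hi hle
        rw [h1]
        push_cast
        linarith
    obtain ⟨i, hi⟩ := exists_nat_gt (T^[m] x / disp τ (T^[m] x))
    rw [div_lt_iff₀ hu] at hi
    linarith [hdec i, hpos (m + i)]
  have hΛ0 : 0 < Λ⁻¹ := by positivity
  suffices h : ∃ m, T^[m] x ∉ interval a 0 ∧ ∃ ψ ω : ℝ → ℝ, IsInvIterate T φ m ψ ω ∧
      ψ (T^[m] x) = x ∧ |ω (T^[m] x)| ≤ Λ⁻¹ ^ k by
    obtain ⟨m, hm, ψ, ω, h1, h2, h3⟩ := h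
    refine ⟨m, ψ, ω, h1, h2, ⟨hpos m, lt_of_le_of_ne (not_lt.1 hm) ?_⟩, h3⟩
    exact fun hh => hxa m ⟨1, hh.symm⟩
  induction k with
  | zero =>
    exact hreturn (m := 0) (by positivity) ⟨id, fun _ => 1, isInvIterate_id hφ0, rfl, by simp⟩
  | succ k ih =>
    obtain ⟨m, hm, ψ, ω, h1, h2, h3⟩ := ih
    obtain ⟨j, hj, hmj⟩ := hT.partition.exists_mem_interval (hpos m) (hxa m)
    have hj1 : 1 ≤ j := by
      rcases Nat.eq_zero_or_pos j with rfl | h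
      · exact absurd hmj hm
      · exact h
    obtain ⟨ψ', ω', h1', h2', h3'⟩ := hstep hj hmj h1 h2 h3
    refine hreturn (by positivity) ⟨ψ', ω', h1', h2', h3'.trans ?_⟩
    rw [pow_succ]
    gcongr
    exact hexp j hj1 hj _ hmj

end IsIntermittent

lemma IsTailSeq.ae_eq_preimage_iterate {α : Type*} [MeasurableSpace α] {ν : Measure α} {T : α → α}
    (hT : MeasurePreserving T ν ν) {C : ℕ → Set α} (hC : IsTailSeq ν T C) (m : ℕ) :
    C 0 =ᵐ[ν] T^[m] ⁻¹' C m := by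
  induction m with
  | zero => rfl
  | succ m ih =>
    refine ih.trans ?_
    rw [Function.iterate_succ', preimage_comp]
    exact (hT.iterate m).quasiMeasurePreserving.preimage_ae_eq (hC m).2

lemma IsTailSeq.diff {α : Type*} [MeasurableSpace α] {ν : Measure α} {T : α → α}
    {C D : ℕ → Set α} (hC : IsTailSeq ν T C) (hD : IsTailSeq ν T D) :
    IsTailSeq ν T fun n => C n \ D n :=
  fun n => ⟨(hC n).1.diff (hD n).1, (hC n).2.diff (hD n).2⟩

lemma IsTailSeq.shift {α : Type*} [MeasurableSpace α] {ν : Measure α} {T : α → α}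
    {C : ℕ → Set α} (hC : IsTailSeq ν T C) : IsTailSeq ν T fun n => C (n + 1) :=
  fun n => hC (n + 1)

/-- A density point of a set: small balls are almost filled by the set. -/
lemma ae_eventually_measureReal_closedBall_diff_le (S : Set ℝ) (hS : MeasurableSet S) {δ : ℝ}
    (hδ : 0 < δ) : ∀ᵐ x ∂(volume.restrict S), ∃ r₀ > 0, ∀ r, 0 < r → r < r₀ →
      volume.real (Metric.closedBall x r \ S) ≤ δ * (2 * r) := by
  filter_upwards [Besicovitch.ae_tendsto_measure_inter_div volume S] with x hx
  have h1 := (ENNReal.tendsto_toReal ENNReal.one_ne_top).comp hx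
  have h2 := h1.eventually_const_lt (u := 1 - δ) (by simpa using hδ)
  obtain ⟨r₀, hr₀, h3⟩ := mem_nhdsGT_iff_exists_Ioo_subset.1 h2
  refine ⟨r₀, hr₀, fun r hr hrr => ?_⟩
  have h4 : 1 - δ < (volume (S ∩ Metric.closedBall x r) / volume (Metric.closedBall x r)).toReal :=
    h3 ⟨hr, hrr⟩
  have hb : volume.real (Metric.closedBall x r) = 2 * r := by
    rw [measureReal_def, Real.volume_closedBall, ENNReal.toReal_ofReal (by positivity)]
  rw [ENNReal.toReal_div, ← measureReal_def, ← measureReal_def, hb, lt_div_iff₀ (by positivity)]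
    at h4
  have h5 := measureReal_inter_add_sdiff (μ := volume) (s := Metric.closedBall x r) hS
    (by rw [Real.volume_closedBall]; exact ENNReal.ofReal_ne_top)
  rw [hb, inter_comm] at h5
  linarith

lemma ae_leb_iff {p : ℝ → Prop} : (∀ᵐ x ∂leb, p x) ↔ ∀ᵐ x, 0 < x → p x := by
  rw [leb, ae_restrict_iff' measurableSet_Ioi]
  rfl

namespace IsIntermittent

variable {T : ℝ → ℝ} {N : ℕ∞} {a : ℕ → ℝ} {τ : ℕ → ℝ → ℝ}

lemma measurePreserving (hT : IsIntermittent T N a τ) (hTm : Measurable T) :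
    MeasurePreserving T leb leb := by
  refine ⟨hTm, Measure.ext fun s hs => ?_⟩
  rw [Measure.map_apply hTm hs, leb, Measure.restrict_apply (hTm hs), Measure.restrict_apply hs,
    ← hT.preserves _ inter_subset_right (hs.inter measurableSet_Ioi)]
  congr 1
  ext x
  simp only [mem_inter_iff, mem_preimage]
  exact ⟨fun h => ⟨h.2, h.1, hT.mapsTo h.2⟩, fun h => ⟨h.2.1, h.1⟩⟩

lemma ae_iterate_notMem_range (hT : IsIntermittent T N a τ) (hTm : Measurable T) :
    ∀ᵐ x ∂leb, ∀ n : ℕ, T^[n] x ∉ range a := by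
  refine ae_all_iff.2 fun n => ?_
  have h : ∀ᵐ x ∂leb, x ∉ range a :=
    measure_eq_zero_iff_ae_notMem.1 (Measure.absolutelyContinuous_of_le Measure.restrict_le_self
      ((countable_range a).measure_zero volume))
  exact ((hT.measurePreserving hTm).iterate n).quasiMeasurePreserving.ae h

/-- The images of a tail set of positive measure fill up any box. -/
lemma exists_measureReal_diff_le (hT : IsIntermittent T N a τ) (hTm : Measurable T)
    {C : ℕ → Set ℝ} (hC : IsTailSeq leb T C) (hpos : ¬ ∀ᵐ x ∂leb, x ∉ C 0) {M ε : ℝ} (hM : 0 < M)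
    (haM : a 1 ≤ M) (hε : 0 < ε) : ∃ m, volume.real (Ioc 0 M \ C m) ≤ ε := by
  obtain ⟨φ, hφ0, hφ, hloc⟩ := hT.exists_distortion_control
  obtain ⟨Λ, hΛ, hexp⟩ := hT.expanding
  obtain ⟨D, hD0, hD⟩ := hloc M
  set c := Real.exp (D * M) with hc
  have hc0 : 0 < c := Real.exp_pos _
  set δ := ε / (2 * c ^ 2 * M) with hδ
  have hδ0 : 0 < δ := by positivity
  set S := C 0 ∩ Ioi 0 with hS
  have hSm : MeasurableSet S := (hC 0).1.inter measurableSet_Ioi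
  obtain ⟨x, hxS, hxa, r₀, hr₀, hball⟩ : ∃ x ∈ S, (∀ n : ℕ, T^[n] x ∉ range a) ∧ ∃ r₀ > 0,
      ∀ r, 0 < r → r < r₀ → volume.real (Metric.closedBall x r \ S) ≤ δ * (2 * r) := by
    have h1 := (ae_restrict_iff' hSm).1 (ae_eventually_measureReal_closedBall_diff_le S hSm hδ0)
    have h2 := ae_leb_iff.1 (hT.ae_iterate_notMem_range hTm)
    rw [ae_leb_iff, Filter.not_eventually] at hpos
    obtain ⟨x, hx, h1, h2⟩ := (hpos.and_eventually (h1.and h2)).exists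
    push Not at hx
    exact ⟨x, ⟨hx.2, hx.1⟩, h2 hx.1, h1 ⟨hx.2, hx.1⟩⟩
  have hx0 : 0 < x := hxS.2
  obtain ⟨k, hk⟩ : ∃ k : ℕ, c * M * Λ⁻¹ ^ k < r₀ := by
    have h := (tendsto_pow_atTop_nhds_zero_of_lt_one (inv_nonneg.2 (by linarith))
      (inv_lt_one_of_one_lt₀ hΛ)).const_mul (c * M)
    rw [mul_zero] at h
    exact (h.eventually_lt_const hr₀).exists
  obtain ⟨m, ψ, ω, hψ, hψx, hm, hω⟩ := hT.exists_isInvIterate hφ0 hφ hΛ hexp hx0 hxa k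
  refine ⟨m, ?_⟩
  set t₀ := T^[m] x
  have ht₀ : t₀ ∈ Ioc 0 M := ⟨hm.1, hm.2.le.trans haM⟩
  have hω0 : 0 < |ω t₀| := abs_pos.2 (hψ.ne_zero _ ht₀.1)
  set r := c * |ω t₀| * M with hr
  have hr0 : 0 < r := by positivity
  have hrr : r < r₀ := lt_of_le_of_lt (by
    calc r = c * M * |ω t₀| := by rw [hr]; ring
      _ ≤ c * M * Λ⁻¹ ^ k := by gcongr) hk
  have hb := hball r hr0 hrr
  set E := Ioc 0 M \ C m with hE
  have hEm : MeasurableSet E := measurableSet_Ioc.diff (hC m).1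
  have hEfin : volume E ≠ ⊤ := measure_ne_top_of_subset sdiff_subset measure_Ioc_lt_top.ne
  have hsub : ψ '' E ⊆ Metric.closedBall x r := by
    rintro _ ⟨t, ht, rfl⟩
    have h := (convex_Ioc 0 M).norm_image_sub_le_of_norm_hasDerivWithin_le
      (fun s hs => (hψ.hasDerivAt s hs.1).hasDerivWithinAt)
      (fun s hs => hψ.abs_le_exp_mul hD hD0 hs ht₀) ht₀ ht.1
    rw [hψx] at h
    rw [Metric.mem_closedBall, dist_eq_norm]
    refine h.trans ?_
    rw [hr]
    gcongr
    rw [Real.norm_eq_abs, abs_le]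
    constructor <;> linarith [ht.1.1, ht.1.2, ht₀.1, ht₀.2]
  have hle : volume (ψ '' E) ≤ volume (Metric.closedBall x r \ S) := by
    refine measure_mono_ae ?_
    have h1 := ae_leb_iff.1 (eventuallyEq_set.1
      (hC.ae_eq_preimage_iterate (hT.measurePreserving hTm) m))
    filter_upwards [h1] with y hy hyE
    refine ⟨hsub hyE, fun hyS => ?_⟩
    have h2 := (hy hyS.2).1 hyS.1
    obtain ⟨t, ht, rfl⟩ := hyE
    rw [mem_preimage, hψ.rightInv t ht.1.1] at h2
    exact ht.2 h2
  have hinj : InjOn ψ E := fun s hs t ht hst => by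
    rw [← hψ.rightInv s hs.1.1, ← hψ.rightInv t ht.1.1, hst]
  have hvol : ENNReal.ofReal (|ω t₀| / c) * volume E ≤ volume (ψ '' E) := by
    have h := lintegral_image_eq_lintegral_abs_deriv_mul hEm
      (fun s hs => (hψ.hasDerivAt s hs.1.1).hasDerivWithinAt) hinj (fun _ => 1)
    simp only [mul_one, lintegral_const, Measure.restrict_apply MeasurableSet.univ, univ_inter,
      one_mul] at h
    rw [h, ← setLIntegral_const]
    refine setLIntegral_mono' hEm fun s hs => ENNReal.ofReal_le_ofReal ?_
    rw [div_le_iff₀ hc0, mul_comm]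
    exact hψ.abs_le_exp_mul hD hD0 ht₀ hs.1
  have hfin : volume (Metric.closedBall x r \ S) ≠ ⊤ :=
    measure_ne_top_of_subset sdiff_subset (by
      rw [Real.volume_closedBall]; exact ENNReal.ofReal_ne_top)
  have hreal : |ω t₀| / c * volume.real E ≤ δ * (2 * r) := by
    have h := ENNReal.toReal_mono hfin (hvol.trans hle)
    rw [ENNReal.toReal_mul, ENNReal.toReal_ofReal (by positivity)] at h
    exact h.trans hb
  have hfinal : |ω t₀| / c * volume.real E ≤ |ω t₀| / c * ε := by
    refine hreal.trans_eq ?_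
    rw [hδ, hr]
    field_simp
  exact le_of_mul_le_mul_left hfinal (by positivity)

/-- The part of a box that is not covered by the images of a tail set grows slowly. -/
lemma measureReal_diff_succ_le (hT : IsIntermittent T N a τ) (hTm : Measurable T) {C : ℕ → Set ℝ}
    (hC : IsTailSeq leb T C) {M : ℝ} (haM : a 1 < M) (m : ℕ) :
    volume.real (Ioc 0 M \ C (m + 1)) ≤ volume.real (Ioc 0 M \ C m) + disp τ M := by
  have hmeas : ∀ n, MeasurableSet (Ioc 0 M \ C n) := fun n => measurableSet_Ioc.diff (hC n).1
  have h1 : volume (Ioc 0 M \ C (m + 1)) = leb (T ⁻¹' (Ioc 0 M \ C (m + 1))) := by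
    rw [(hT.measurePreserving hTm).measure_preimage (hmeas _).nullMeasurableSet, leb,
      Measure.restrict_apply (hmeas _)]
    congr 1
    exact (inter_eq_left.2 (sdiff_subset.trans Ioc_subset_Ioi_self)).symm
  have h2 : volume (Ioc 0 M \ C (m + 1)) ≤
      volume ((Ioc 0 M \ C m) ∪ Ioc M (M + disp τ M)) := by
    rw [h1, leb, Measure.restrict_apply (hTm (hmeas _))]
    refine measure_mono_ae ?_
    filter_upwards [ae_leb_iff.1 (eventuallyEq_set.1 (hC m).2)] with x hx hxm
    obtain ⟨⟨⟨-, h3⟩, h4⟩, h5⟩ := hxm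
    rcases le_or_gt x M with hxM | hxM
    · exact Or.inl ⟨⟨h5, hxM⟩, fun h => h4 ((hx h5).1 h)⟩
    · refine Or.inr ⟨hxM, ?_⟩
      have h6 := hT.eqOn 0 hT.partition.zero_lt (haM.trans hxM)
      have h7 := hT.disp_antitone haM hxM.le
      have h8 : disp τ x = x - T x := by rw [← h6, disp]
      linarith
  have hfin : volume ((Ioc 0 M \ C m) ∪ Ioc M (M + disp τ M)) ≠ ⊤ :=
    (measure_union_lt_top (measure_ne_top_of_subset sdiff_subset measure_Ioc_lt_top.ne).lt_top
      measure_Ioc_lt_top).ne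
  have h3 := (ENNReal.toReal_mono hfin h2).trans (measureReal_union_le _ _)
  rwa [Real.volume_real_Ioc_of_le (by linarith [hT.disp_pos haM]), add_sub_cancel_left] at h3

lemma exists_box (hT : IsIntermittent T N a τ) : ∃ M, 0 < M ∧ a 1 < M ∧ disp τ M < M / 4 := by
  have h1 : ∀ᶠ M in atTop, disp τ M < 1 := hT.u_tendsto.eventually_lt_const one_pos
  obtain ⟨M, h1, h2, h3⟩ := (h1.and ((eventually_gt_atTop (a 1)).and (eventually_gt_atTop 4))).exists
  exact ⟨M, by linarith, h2, by linarith⟩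

lemma measureReal_box_le {M : ℝ} (hM : 0 < M) {A B : Set ℝ} (hAB : Disjoint A B) :
    M ≤ volume.real (Ioc 0 M \ A) + volume.real (Ioc 0 M \ B) := by
  have h1 : volume.real (Ioc 0 M) = M := by rw [Real.volume_real_Ioc_of_le hM.le, sub_zero]
  have hfin : ∀ A : Set ℝ, volume (Ioc 0 M \ A) ≠ ⊤ := fun A =>
    measure_ne_top_of_subset sdiff_subset measure_Ioc_lt_top.ne
  calc M = volume.real (Ioc 0 M) := h1.symm
    _ ≤ volume.real ((Ioc 0 M \ A) ∪ (Ioc 0 M \ B)) := by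
        refine measureReal_mono ?_
          (measure_union_lt_top (hfin A).lt_top (hfin B).lt_top).ne
        rw [← sdiff_inter, hAB.inter_eq, sdiff_empty]
    _ ≤ _ := measureReal_union_le _ _

lemma ae_notMem_of_disjoint_succ (hT : IsIntermittent T N a τ) (hTm : Measurable T)
    {C : ℕ → Set ℝ} (hC : IsTailSeq leb T C) (hdisj : ∀ n, Disjoint (C n) (C (n + 1))) :
    ∀ᵐ x ∂leb, x ∉ C 0 := by
  by_contra hpos
  obtain ⟨M, hM, haM, hdM⟩ := hT.exists_box
  obtain ⟨m, hm⟩ := hT.exists_measureReal_diff_le hTm hC hpos hM haM.le (ε := M / 4) (by positivity)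
  have h1 := hT.measureReal_diff_succ_le hTm hC haM m
  have h2 := measureReal_box_le hM (hdisj m)
  linarith

/-- `T` is exact: its tail σ-algebra is trivial. -/
theorem tailTrivial (hT : IsIntermittent T N a τ) (hTm : Measurable T) : TailTrivial leb T := by
  intro C hC
  have h1 := hT.ae_notMem_of_disjoint_succ hTm (hC.diff hC.shift)
    fun n => disjoint_sdiff_left.mono_right sdiff_subset
  have h2 := hT.ae_notMem_of_disjoint_succ hTm (hC.shift.diff hC)
    fun n => disjoint_sdiff_right.mono_left sdiff_subset
  have h3 : C 1 =ᵐ[leb] C 0 := by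
    refine eventuallyEq_set.2 ?_
    filter_upwards [h1, h2] with x hx1 hx2
    simp only [Set.mem_sdiff, not_and, not_not] at hx1 hx2
    exact ⟨hx2, hx1⟩
  have hinv : IsTailSeq leb T fun _ => C 0 := fun _ => ⟨(hC 0).1, (hC 0).2.trans
    ((hT.measurePreserving hTm).quasiMeasurePreserving.preimage_ae_eq h3)⟩
  have huniv : IsTailSeq leb T fun _ => univ := fun _ => ⟨MeasurableSet.univ, by rfl⟩
  by_contra hcon
  rw [not_or] at hcon
  obtain ⟨M, hM, haM, -⟩ := hT.exists_box
  obtain ⟨_, h4⟩ := hT.exists_measureReal_diff_le hTm hinv hcon.2 hM haM.le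
    (ε := M / 4) (by positivity)
  obtain ⟨_, h5⟩ := hT.exists_measureReal_diff_le hTm (huniv.diff hinv) (by simpa using hcon.1)
    hM haM.le (ε := M / 4) (by positivity)
  have h6 := measureReal_box_le hM (disjoint_sdiff_right (s := C 0) (t := univ))
  linarith

lemma congr {T' : ℝ → ℝ} (hT : IsIntermittent T N a τ) (h : EqOn T T' (Ioi 0)) :
    IsIntermittent T' N a τ :=
  { hT with
    mapsTo := hT.mapsTo.congr h
    bijOn := fun j hj => (hT.bijOn j hj).congr (h.mono (hT.partition.interval_subset hj))
    eqOn := fun j hj => (hT.eqOn j hj).trans (h.mono (hT.partition.interval_subset hj))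
    preserves := fun A hA hAm => by
      rw [← h.inter_preimage_eq]
      exact hT.preserves A hA hAm }

lemma exists_measurable_eqOn (hT : IsIntermittent T N a τ) :
    ∃ T' : ℝ → ℝ, Measurable T' ∧ EqOn T T' (Ioi 0) := by
  classical
  refine ⟨(Ioi 0).piecewise T id, fun s hs => ?_, fun x hx => (piecewise_eq_of_mem _ _ _ hx).symm⟩
  have hj : ∀ j : {j : ℕ // (j : ℕ∞) < N}, MeasurableSet (interval a j ∩ τ j ⁻¹' s) := fun j => by
    have h1 : Measurable ((interval a j).piecewise (τ j) fun _ => 0) :=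
      ContinuousOn.measurable_piecewise (hT.contDiffOn_interval j.2).continuousOn
        continuousOn_const (measurableSet_interval a j)
    convert (measurableSet_interval a j).inter (h1 hs) using 1
    ext x
    by_cases hx : x ∈ interval a j <;> simp [hx]
  have heq : (Ioi (0 : ℝ)).piecewise T id ⁻¹' s = (Iic 0 ∩ s) ∪
      ((⋃ j : {j : ℕ // (j : ℕ∞) < N}, interval a j ∩ τ j ⁻¹' s) ∪
        (range a ∩ (Ioi (0 : ℝ)).piecewise T id ⁻¹' s)) := by
    ext x
    rcases le_or_gt x 0 with hx | hx
    · have h1 : ∀ j : {j : ℕ // (j : ℕ∞) < N}, x ∉ interval a j := fun j h =>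
        absurd (hT.partition.interval_subset j.2 h) (not_lt.2 hx)
      simp [h1, hx, not_lt.2 hx]
    · by_cases hxa : x ∈ range a
      · have h1 : ∀ j : {j : ℕ // (j : ℕ∞) < N}, x ∈ interval a j → τ j x = T x := fun j h =>
          hT.eqOn j j.2 h
        have h2 : (Ioi (0 : ℝ)).piecewise T id x = T x := piecewise_eq_of_mem _ _ _ hx
        simp only [mem_union, mem_inter_iff, mem_Iic, mem_iUnion, mem_preimage, h2, hxa]
        constructor
        · exact fun h => Or.inr (Or.inr ⟨trivial, h⟩)
        · rintro (h | ⟨j, h3, h4⟩ | h)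
          · exact absurd h.1 (not_le.2 hx)
          · rwa [h1 j h3] at h4
          · exact h.2
      · obtain ⟨j, hjN, hxj⟩ := hT.partition.exists_mem_interval hx hxa
        have h1 : ∀ j : {j : ℕ // (j : ℕ∞) < N}, x ∈ interval a j → τ j x = T x := fun j h =>
          hT.eqOn j j.2 h
        have h2 : (Ioi (0 : ℝ)).piecewise T id x = T x := piecewise_eq_of_mem _ _ _ hx
        simp only [mem_union, mem_inter_iff, mem_Iic, mem_iUnion, mem_preimage, h2]
        constructor
        · intro h
          refine Or.inr (Or.inl ⟨⟨j, hjN⟩, hxj, ?_⟩)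
          rwa [h1 ⟨j, hjN⟩ hxj]
        · rintro (h | ⟨j, h3, h4⟩ | h)
          · exact absurd h.1 (not_le.2 hx)
          · rwa [h1 j h3] at h4
          · exact h.2
  rw [heq]
  refine (measurableSet_Iic.inter hs).union ((MeasurableSet.iUnion hj).union ?_)
  exact ((countable_range a).mono inter_subset_left).measurableSet

end IsIntermittent

namespace IsIntermittent

variable {T : ℝ → ℝ} {N : ℕ∞} {a : ℕ → ℝ} {τ : ℕ → ℝ → ℝ}

lemma tendsto_apply_sub_self (hT : IsIntermittent T N a τ) :
    Tendsto (fun x => T x - x) atTop (𝓝 0) := by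
  have h := hT.u_tendsto.neg
  rw [neg_zero] at h
  refine h.congr' ?_
  filter_upwards [eventually_gt_atTop (a 1)] with x hx
  rw [hT.eqOn 0 hT.partition.zero_lt hx]
  ring

lemma iterate_eqOn (hT : IsIntermittent T N a τ) {T' : ℝ → ℝ} (h : EqOn T T' (Ioi 0)) (n : ℕ) :
    EqOn (T^[n]) (T'^[n]) (Ioi 0) := by
  induction n with
  | zero => exact fun x _ => rfl
  | succ n ih =>
    intro x hx
    rw [Function.iterate_succ_apply', Function.iterate_succ_apply', ← ih hx]
    exact h (hT.mapsTo.iterate n hx)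

lemma aemeasurable_iterate (hT : IsIntermittent T N a τ) (n : ℕ) : AEMeasurable (T^[n]) leb := by
  obtain ⟨T', hm, h⟩ := hT.exists_measurable_eqOn
  exact ⟨T'^[n], hm.iterate n, (ae_restrict_mem measurableSet_Ioi).mono (hT.iterate_eqOn h n)⟩

variable {𝕜 : Type*} [RCLike 𝕜]

/-- Bounded observables mix with mean zero local observables. -/
lemma tendsto_integral_comp_iterate_mul (hT : IsIntermittent T N a τ) {F g : ℝ → 𝕜}
    (hF : MemLp F ⊤ leb) (hg : Integrable g leb) (h0 : ∫ x, g x ∂leb = 0) :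
    Tendsto (fun n : ℕ => ∫ x, F (T^[n] x) * g x ∂leb) atTop (𝓝 0) := by
  obtain ⟨T', hm, h⟩ := hT.exists_measurable_eqOn
  have hT' := hT.congr h
  refine ((hT'.tailTrivial hm).tendsto_integral_comp_iterate_mul (hT'.measurePreserving hm)
    hF hg h0).congr fun n => integral_congr_ae ?_
  filter_upwards [ae_restrict_mem measurableSet_Ioi] with x hx
  rw [hT.iterate_eqOn h n hx]

lemma norm_setIntegral_comp_iterate_le (hT : IsIntermittent T N a τ) {f : ℝ → 𝕜}
    (hf : Integrable f leb) (n : ℕ) (s : Set ℝ) :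
    Integrable (fun x => f (T^[n] x)) leb ∧
      ‖∫ x in s, f (T^[n] x) ∂leb‖ ≤ ∫ x, ‖f x‖ ∂leb := by
  obtain ⟨T', hm, h⟩ := hT.exists_measurable_eqOn
  have hmp := ((hT.congr h).measurePreserving hm).iterate n
  have hae : (fun x => f (T'^[n] x)) =ᵐ[leb] fun x => f (T^[n] x) := by
    filter_upwards [ae_restrict_mem measurableSet_Ioi] with x hx
    rw [hT.iterate_eqOn h n hx]
  have hi : Integrable (fun x => f (T'^[n] x)) leb := hmp.integrable_comp_of_integrable hf
  have hi' := hi.congr hae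
  refine ⟨hi', ?_⟩
  calc ‖∫ x in s, f (T^[n] x) ∂leb‖ ≤ ∫ x in s, ‖f (T^[n] x)‖ ∂leb :=
        norm_integral_le_integral_norm _
    _ ≤ ∫ x, ‖f (T^[n] x)‖ ∂leb :=
        setIntegral_le_integral hi'.norm (ae_of_all _ fun x => norm_nonneg _)
    _ = ∫ x, ‖f (T'^[n] x)‖ ∂leb := (integral_congr_ae (hae.fun_comp _)).symm
    _ = ∫ x, ‖f x‖ ∂leb := by
        have := integral_map (μ := leb) hmp.aemeasurable
          (f := fun x => ‖f x‖) (by rw [hmp.map_eq]; exact hf.1.norm)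
        rw [hmp.map_eq] at this
        exact this.symm

theorem glm1 (hT : IsIntermittent T N a τ) : GLM1 𝕜 T :=
  fun _ _ hF hg h0 => hT.tendsto_integral_comp_iterate_mul hF.1 hg h0

theorem llm (hT : IsIntermittent T N a τ) : LLM 𝕜 T := by
  intro f g hf hfG hg
  set c := ∫ x, g x ∂leb with hc
  set I := ∫ x, ‖f x‖ ∂leb with hI
  have hI0 : 0 ≤ I := integral_nonneg fun x => norm_nonneg _
  rw [Metric.tendsto_atTop]
  intro ε hε
  obtain ⟨M, hM0, hM⟩ : ∃ M : ℝ, 0 < M ∧ M⁻¹ * ‖c‖ * I < ε / 2 := by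
    have h := (tendsto_inv_atTop_zero (𝕜 := ℝ)).mul_const (‖c‖ * I)
    rw [zero_mul] at h
    obtain ⟨M, h1, h2⟩ := ((h.eventually_lt_const (half_pos hε)).and (eventually_gt_atTop 0)).exists
    exact ⟨M, h2, by rwa [mul_assoc]⟩
  set b : 𝕜 := (M⁻¹ : ℝ) • c with hb
  set e : ℝ → 𝕜 := (Ioc 0 M).indicator fun _ => b with he
  have hsub : Ioc (0 : ℝ) M ∩ Ioi 0 = Ioc 0 M := inter_eq_left.2 Ioc_subset_Ioi_self
  have hleb : leb.restrict (Ioc 0 M) = volume.restrict (Ioc 0 M) := by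
    rw [leb, Measure.restrict_restrict measurableSet_Ioc, hsub]
  have hei : Integrable e leb := by
    rw [he, integrable_indicator_iff measurableSet_Ioc, IntegrableOn, hleb]
    exact integrableOn_const measure_Ioc_lt_top.ne
  have heint : ∫ x, e x ∂leb = c := by
    rw [he, integral_indicator measurableSet_Ioc, hleb, setIntegral_const,
      Real.volume_real_Ioc_of_le hM0.le, sub_zero, hb, smul_inv_smul₀ hM0.ne']
  have hg' : Integrable (fun x => g x - e x) leb := Integrable.sub hg hei
  have h0 : ∫ x, (g x - e x) ∂leb = 0 := by
    rw [integral_sub hg hei, heint, hc, sub_self]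
  obtain ⟨n₀, hn₀⟩ := Metric.tendsto_atTop.1
    (hT.tendsto_integral_comp_iterate_mul hfG.1 hg' h0) (ε / 2) (half_pos hε)
  refine ⟨n₀, fun n hn => ?_⟩
  obtain ⟨hfi, hfle⟩ := hT.norm_setIntegral_comp_iterate_le hf n (Ioc 0 M)
  have hmul : (fun x => f (T^[n] x) * e x) = (Ioc 0 M).indicator fun x => f (T^[n] x) * b := by
    funext x
    by_cases hx : x ∈ Ioc 0 M <;> simp [he, hx]
  have hfe : Integrable (fun x => f (T^[n] x) * e x) leb := by
    rw [hmul]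
    exact (hfi.mul_const b).indicator measurableSet_Ioc
  have hfeint : ‖∫ x, f (T^[n] x) * e x ∂leb‖ < ε / 2 := by
    rw [hmul, integral_indicator measurableSet_Ioc, integral_mul_const, norm_mul, hb, norm_smul,
      Real.norm_of_nonneg (inv_nonneg.2 hM0.le)]
    refine lt_of_le_of_lt ?_ hM
    rw [mul_comm]
    gcongr
  have hfg : Integrable (fun x => f (T^[n] x) * (g x - e x)) leb := by
    obtain ⟨T', hm, h⟩ := hT.exists_measurable_eqOn
    have hmp := ((hT.congr h).measurePreserving hm).iterate n
    have hL : MemLp (fun x => f (T^[n] x)) ⊤ leb := by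
      refine (hfG.1.comp_measurePreserving hmp).ae_eq ?_
      filter_upwards [ae_restrict_mem measurableSet_Ioi] with x hx
      rw [Function.comp_apply, hT.iterate_eqOn h n hx]
    exact hg'.mul_of_top_right hL
  have hsum : ∫ x, f (T^[n] x) * g x ∂leb =
      ∫ x, f (T^[n] x) * (g x - e x) ∂leb + ∫ x, f (T^[n] x) * e x ∂leb := by
    rw [← integral_add hfg hfe]
    congr 1
    funext x
    ring
  have h1 := hn₀ n hn
  rw [dist_zero_right] at h1 ⊢
  rw [hsum]
  exact (norm_add_le _ _).trans_lt (by linarith)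

end IsIntermittent

end HalfLine

theorem proposition2p5 (𝕜 : Type*) [RCLike 𝕜] (T : ℝ → ℝ) (N : ℕ∞) (a : ℕ → ℝ)
    (τ : ℕ → ℝ → ℝ) (hT : HalfLine.IsIntermittent T N a τ) :
    HalfLine.GLM1 𝕜 T ∧ HalfLine.LLM 𝕜 T ∧
      ¬ HalfLine.GLM3 𝕜 T ∧ ¬ HalfLine.GGM1 𝕜 T ∧ ¬ HalfLine.WeakGGM1 𝕜 T ∧
      ¬ HalfLine.GGM2 𝕜 T :=
  ⟨hT.glm1, hT.llm, HalfLine.not_GLM3 𝕜 hT.aemeasurable_iterate hT.tendsto_apply_sub_self,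
    HalfLine.not_GGM1 𝕜 hT.aemeasurable_iterate hT.tendsto_apply_sub_self,
    HalfLine.not_weakGGM1 𝕜 hT.aemeasurable_iterate hT.tendsto_apply_sub_self,
    HalfLine.not_GGM2 𝕜 hT.aemeasurable_iterate hT.tendsto_apply_sub_self⟩
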